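/- **Setting.** Let $F$ be Thompson's group, realized as the group $\mathrm{PL}_2(\mathbb R)$ (under composition, $(fg)(t)=f(g(t))$) of all piecewise-linear orientation-preserving homeomorphisms of $\mathbb R$ that have finitely many breakpoints, all with dyadic rational coordinates, all slopes powers of $2$, and that are of the form $t\mapsto t-m$ near $-\infty$ and $t\mapsto t-n$ near $+\infty$ with $m,n\in\mathbb Z$. Let $x_0(t)=t-1$, and let $x_1(t)=t$ for $t\le 0$, $x_1(t)=t/2$ for $0\le t\le 2$, $x_1(t)=t-1$ for $t\ge 2$. Words are words in $x_0^{\pm1},x_1^{\pm1}$; a minimum-length word for $f$ is a shortest word representing $f$. **Forest diagrams.** A bounded binary forest is a sequence $(T_i)_{i\in\mathbb Z}$ of finite binary trees, all but finitely many of them trivial, with a pointer at $T_0$. The root of $T_i$ represents $[i,i+1]$ and the two children of a node (a caret) represent the halves of its interval. A forest diagram is a pair of bounded binary forests (bottom and top) with an order-preserving bijection of their leaves; it is a diagram for $f\in F$ if $f$ maps the interval of each bottom leaf linearly onto the interval of the corresponding top leaf. It is reduced if there is no bottom caret with two leaf children whose leaves correspond to the two leaf children of a top caret. **Lengths.** The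 support of a diagram is the smallest interval of columns containing both pointed-to trees and all nontrivial trees; its spaces are the gaps between consecutive columns of the support. In each of the two forests, a space is labeled $L$ if it is exterior (between two different trees) and to the left of the pointer; otherwise $N$ if it lies immediately to the left of some caret; otherwise $R$ if it is exterior (and to the right of the pointer); otherwise $I$. The weight of a space with top and bottom labels $\{a,b\}$ is $2$ for $\{L,L\}$; $1$ if exactly one label is $L$; $2$ if no label is $L$ and at least one is $N$; $2$ for $\{R,R\}$; and $0$ for $\{R,I\}$ and $\{I,I\}$. For $f$ with reduced diagram $\mathfrak f$, $\ell_0(f)$ is the sum of the weights of all spaces in the support of $\mathfrak f$, and $\ell_1(f)$ is the total number of carets in $\mathfrak f$. **Creation of carets.** A word is read from right to left, so an instance of a letter $s$ in $w=u\,s\,v$ leads from the element $g$ represented by $v$ to $sg$. An instance of $x_1$ *creates a top caret of* $\mathfrak f$ if the reduced diagram of $x_1g$ arises from that of $g$ by attaching a caret to the roots of $T_0$ and $T_1$ in the top forest (the bottom forest being unchanged), and this caret is a caret of the top forest of $\mathfrak f$ (top carets in diagrams of different elements being the same if their left children, and their right children, lie over the same part of the domain line). An instance of $x_1^{-1}$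 *creates a bottom caret of* $\mathfrak f$ if the top tree $T_0$ of the reduced diagram of $g$ is trivial, the reduced diagram of $x_1^{-1}g$ arises by attaching a caret to the bottom leaf under the top pointer and inserting a trivial top tree to the right of the pointer, and this caret is a caret of the bottom forest of $\mathfrak f$. **Statement.** Let $f\in F$. Then $f$ has a unique reduced forest diagram $\mathfrak f$, and there is a minimum-length word $w$ for $f$ such that 1. each instance of $x_1$ in $w$ creates a top caret of $\mathfrak f$, and 2. each instance of $x_1^{-1}$ in $w$ creates a bottom caret of $\mathfrak f$. Moreover, every minimum-length word for $f$ with properties 1 and 2 has exactly $\ell_1(f)$ instances of $x_1^{\pm1}$ and exactly $\ell_0(f)$ instances of $x_0^{\pm1}$. -/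

import Mathlib

namespace ThompsonF

open Set Filter

noncomputable section

/-! ### The group `PL₂(ℝ)`, i.e. Thompson's group `F` -/

/-- Dyadic rational numbers. -/
def IsDyadic (x : ℝ) : Prop := ∃ (a : ℤ) (n : ℕ), x = a / 2 ^ n

/-- `f` is an element of `PL₂(ℝ)`: an orientation-preserving self-homeomorphism of the line
(an order isomorphism) which is piecewise linear with finitely many breakpoints, all of them with
dyadic rational coordinates, whose slopes are powers of two, and which is a translation by an
integer near `-∞` and near `+∞`. -/
structure IsPL2 (f : ℝ ≃o ℝ) : Prop where
  pieces : ∃ B : Finset ℝ, (∀ b ∈ B, IsDyadic b ∧ IsDyadic (f b)) ∧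
    ∀ u v : ℝ, u < v → (∀ t ∈ Ioo u v, t ∉ B) →
      ∃ (k : ℤ) (c : ℝ), ∀ t ∈ Icc u v, f t = (2 : ℝ) ^ k * t + c
  left_end : ∃ m : ℤ, ∀ᶠ t in atBot, f t = t - m
  right_end : ∃ n : ℤ, ∀ᶠ t in atTop, f t = t - n

theorem IsDyadic.add {x y : ℝ} (hx : IsDyadic x) (hy : IsDyadic y) : IsDyadic (x + y) := by
  obtain ⟨a, n, rfl⟩ := hx
  obtain ⟨b, m, rfl⟩ := hy
  refine ⟨a * 2 ^ m + b * 2 ^ n, n + m, ?_⟩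
  push_cast
  field_simp
  ring

theorem IsDyadic.neg {x : ℝ} (hx : IsDyadic x) : IsDyadic (-x) := by
  obtain ⟨a, n, rfl⟩ := hx
  refine ⟨-a, n, ?_⟩
  push_cast
  ring

theorem IsDyadic.intCast (m : ℤ) : IsDyadic (m : ℝ) := ⟨m, 0, by simp⟩

theorem IsDyadic.zpow_mul {x : ℝ} (k : ℤ) (hx : IsDyadic x) : IsDyadic ((2 : ℝ) ^ k * x) := by
  obtain ⟨a, n, rfl⟩ := hx
  obtain ⟨j, rfl | rfl⟩ := k.eq_nat_or_neg
  · refine ⟨2 ^ j * a, n, ?_⟩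
    push_cast
    rw [zpow_natCast]
    ring
  · refine ⟨a, j + n, ?_⟩
    rw [zpow_neg, zpow_natCast, pow_add]
    field_simp

theorem IsPL2.dyadic {f : ℝ ≃o ℝ} (hf : IsPL2 f) {t : ℝ} (ht : IsDyadic t) :
    IsDyadic (f t) := by
  obtain ⟨B, hB, hp⟩ := hf.pieces
  by_cases h : (B.filter (· ≤ t)).Nonempty
  · set b := (B.filter (· ≤ t)).max' h with hb
    have hbm := (B.filter (· ≤ t)).max'_mem h
    rw [← hb, Finset.mem_filter] at hbm
    rcases hbm.2.eq_or_lt with e | hlt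
    · rw [← e]
      exact (hB b hbm.1).2
    · obtain ⟨k, c, hk⟩ := hp b t hlt (by
        intro s hs hsB
        have := (B.filter (· ≤ t)).le_max' s (by simp [hsB, hs.2.le])
        exact absurd hs.1 (not_lt.mpr this))
      have h1 := hk b ⟨le_rfl, hlt.le⟩
      have h2 := hk t ⟨hlt.le, le_rfl⟩
      have : f t = f b + (2 : ℝ) ^ k * (t + -b) := by rw [h1, h2]; ring
      rw [this]
      exact (hB b hbm.1).2.add ((ht.add (hB b hbm.1).1.neg).zpow_mul k)
  · obtain ⟨m, hm⟩ := hf.left_end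
    obtain ⟨A, hA⟩ := eventually_atBot.mp hm
    have l1 := min_le_left A t
    have l2 := min_le_right A t
    obtain ⟨k, c, hk⟩ := hp (min A t - 2) t (by linarith) (by
      intro s hs hsB
      exact h ⟨s, by simp [hsB, hs.2.le]⟩)
    have h1 := hk (min A t - 2) ⟨le_rfl, by linarith⟩
    have h2 := hk (min A t - 1) ⟨by linarith, by linarith⟩
    have h3 := hk t ⟨by linarith, le_rfl⟩
    rw [hA _ (by linarith)] at h1 h2
    have e : (2 : ℝ) ^ k = 1 := by linarith
    rw [e] at h1 h3
    have : f t = t + -(m : ℝ) := by linarith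
    rw [this]
    exact ht.add (IsDyadic.intCast m).neg

theorem IsPL2.one : IsPL2 1 where
  pieces := ⟨∅, by simp, fun _ _ _ _ => ⟨0, 0, fun t _ => by simp⟩⟩
  left_end := ⟨0, by simp⟩
  right_end := ⟨0, by simp⟩

theorem IsPL2.inv {f : ℝ ≃o ℝ} (hf : IsPL2 f) : IsPL2 f⁻¹ where
  pieces := by
    obtain ⟨B, hB, hp⟩ := hf.pieces
    refine ⟨B.image f, ?_, ?_⟩
    · intro b hb
      obtain ⟨s, hs, rfl⟩ := Finset.mem_image.mp hb
      have : f⁻¹ (f s) = s := f.symm_apply_apply s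
      rw [this]
      exact ⟨(hB s hs).2, (hB s hs).1⟩
    · intro u v huv h
      obtain ⟨k, c, hk⟩ := hp (f.symm u) (f.symm v) (f.symm.strictMono huv) (by
        intro t ht htB
        refine h (f t) ⟨?_, ?_⟩ (Finset.mem_image_of_mem _ htB)
        · simpa using f.strictMono ht.1
        · simpa using f.strictMono ht.2)
      refine ⟨-k, -((2 : ℝ) ^ (-k) * c), ?_⟩
      intro t ht
      have h1 := hk (f.symm t) ⟨f.symm.monotone ht.1, f.symm.monotone ht.2⟩
      rw [f.apply_symm_apply] at h1
      change f.symm t = _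
      have h2 : (2 : ℝ) ^ k ≠ 0 := by positivity
      rw [zpow_neg]
      field_simp
      linarith
  left_end := by
    obtain ⟨m, hm⟩ := hf.left_end
    refine ⟨-m, ?_⟩
    filter_upwards [f.symm.tendsto_atBot.eventually hm] with t ht
    rw [f.apply_symm_apply] at ht
    change f.symm t = _
    push_cast
    linarith
  right_end := by
    obtain ⟨m, hm⟩ := hf.right_end
    refine ⟨-m, ?_⟩
    filter_upwards [f.symm.tendsto_atTop.eventually hm] with t ht
    rw [f.apply_symm_apply] at ht
    change f.symm t = _
    push_cast
    linarith

theorem IsPL2.mul {f g : ℝ ≃o ℝ} (hf : IsPL2 f) (hg : IsPL2 g) : IsPL2 (f * g) where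
  pieces := by
    obtain ⟨B, hB, hp⟩ := hf.pieces
    obtain ⟨C, hC, hq⟩ := hg.pieces
    refine ⟨C ∪ B.image g.symm, ?_, ?_⟩
    · intro b hb
      change _ ∧ IsDyadic (f (g b))
      rcases Finset.mem_union.mp hb with h | h
      · exact ⟨(hC b h).1, hf.dyadic (hC b h).2⟩
      · obtain ⟨s, hs, rfl⟩ := Finset.mem_image.mp h
        rw [g.apply_symm_apply]
        exact ⟨hg.inv.dyadic (hB s hs).1, (hB s hs).2⟩
    · intro u v huv h
      obtain ⟨k, c, hk⟩ := hq u v huv (fun t ht htC => h t ht (Finset.mem_union_left _ htC))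
      obtain ⟨j, d, hj⟩ := hp (g u) (g v) (g.strictMono huv) (by
        intro t ht htB
        refine h (g.symm t) ⟨?_, ?_⟩
          (Finset.mem_union_right _ (Finset.mem_image_of_mem _ htB))
        · simpa using g.symm.strictMono ht.1
        · simpa using g.symm.strictMono ht.2)
      refine ⟨j + k, (2 : ℝ) ^ j * c + d, fun t ht => ?_⟩
      change f (g t) = _
      rw [hj (g t) ⟨g.monotone ht.1, g.monotone ht.2⟩, hk t ht, zpow_add₀ (by norm_num)]
      ring
  left_end := by
    obtain ⟨m, hm⟩ := hf.left_end
    obtain ⟨n, hn⟩ := hg.left_end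
    refine ⟨n + m, ?_⟩
    filter_upwards [hn, g.tendsto_atBot.eventually hm] with t h1 h2
    change f (g t) = _
    rw [h2, h1]
    push_cast
    ring
  right_end := by
    obtain ⟨m, hm⟩ := hf.right_end
    obtain ⟨n, hn⟩ := hg.right_end
    refine ⟨n + m, ?_⟩
    filter_upwards [hn, g.tendsto_atTop.eventually hm] with t h1 h2
    change f (g t) = _
    rw [h2, h1]
    push_cast
    ring

/-- Thompson's group `F`, as the group `PL₂(ℝ)` of homeomorphisms of the line; the product is
composition, `(f * g) t = f (g t)`. -/
def F : Subgroup (ℝ ≃o ℝ) where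
  carrier := {f | IsPL2 f}
  one_mem' := IsPL2.one
  mul_mem' := IsPL2.mul
  inv_mem' := IsPL2.inv

/-- The homeomorphism `t ↦ t - 1`. -/
def x₀Map : ℝ ≃o ℝ := OrderIso.subRight 1

/-- The homeomorphism which is `t` for `t ≤ 0`, `t / 2` for `0 ≤ t ≤ 2`, and `t - 1` for
`2 ≤ t`. -/
def x₁Map : ℝ ≃o ℝ :=
  StrictMono.orderIsoOfRightInverse
    (fun t => if t ≤ 0 then t else if t ≤ 2 then t / 2 else t - 1)
    (by
      intro a b hab
      dsimp only
      split_ifs <;> linarith)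
    (fun t => if t ≤ 0 then t else if t ≤ 1 then 2 * t else t + 1)
    (by
      intro t
      dsimp only
      split_ifs <;> linarith)

theorem x₁Map_apply (t : ℝ) :
    x₁Map t = if t ≤ 0 then t else if t ≤ 2 then t / 2 else t - 1 := rfl

theorem x₀Map_mem : x₀Map ∈ F where
  pieces := ⟨∅, by simp, fun _ _ _ _ => ⟨0, -1, fun t _ => by simp [x₀Map]; ring⟩⟩
  left_end := ⟨1, by simp [x₀Map]⟩
  right_end := ⟨1, by simp [x₀Map]⟩

theorem x₁Map_mem : x₁Map ∈ F where
  pieces := by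
    refine ⟨{0, 2}, ?_, ?_⟩
    · intro b hb
      rw [Finset.mem_insert, Finset.mem_singleton] at hb
      rcases hb with rfl | rfl
      · rw [x₁Map_apply, if_pos le_rfl]
        exact ⟨⟨0, 0, by simp⟩, ⟨0, 0, by simp⟩⟩
      · rw [x₁Map_apply, if_neg (by norm_num), if_pos le_rfl]
        exact ⟨⟨2, 0, by simp⟩, ⟨1, 0, by simp⟩⟩
    · intro u v huv h
      have h0 : ¬ (u < 0 ∧ 0 < v) := fun hc => h 0 hc (by simp)
      have h2 : ¬ (u < 2 ∧ 2 < v) := fun hc => h 2 hc (by simp)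
      by_cases c1 : v ≤ 0
      · refine ⟨0, 0, fun t ht => ?_⟩
        rw [x₁Map_apply, if_pos (ht.2.trans c1)]
        simp
      · have c2 : 0 ≤ u := by
          by_contra hu
          exact h0 ⟨not_le.mp hu, not_le.mp c1⟩
        by_cases c3 : v ≤ 2
        · refine ⟨-1, 0, fun t ht => ?_⟩
          rw [x₁Map_apply, zpow_neg_one]
          have := ht.1
          have := ht.2
          split_ifs <;> linarith
        · have c4 : 2 ≤ u := by
            by_contra hu
            exact h2 ⟨not_le.mp hu, not_le.mp c3⟩
          refine ⟨0, -1, fun t ht => ?_⟩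
          rw [x₁Map_apply, zpow_zero]
          have := ht.1
          split_ifs <;> linarith
  left_end := by
    refine ⟨0, ?_⟩
    filter_upwards [eventually_le_atBot 0] with t ht
    rw [x₁Map_apply, if_pos ht]
    simp
  right_end := by
    refine ⟨1, ?_⟩
    filter_upwards [eventually_gt_atTop 2] with t ht
    rw [x₁Map_apply, if_neg (by linarith), if_neg (by linarith)]
    simp

/-- The generator `x₀` of `F`. -/
def x₀ : F := ⟨x₀Map, x₀Map_mem⟩

/-- The generator `x₁` of `F`. -/
def x₁ : F := ⟨x₁Map, x₁Map_mem⟩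

/-! ### Words -/

/-- The letters `x₀`, `x₀⁻¹`, `x₁`, `x₁⁻¹`. -/
inductive Letter : Type
  | x0
  | x0inv
  | x1
  | x1inv
  deriving DecidableEq

/-- The element of `F` denoted by a letter. -/
def Letter.val : Letter → F
  | .x0 => x₀
  | .x0inv => x₀⁻¹
  | .x1 => x₁
  | .x1inv => x₁⁻¹

/-- Words in the letters `x₀^{±1}`, `x₁^{±1}`. -/
abbrev Word : Type := List Letter

/-- The element of `F` represented by a word (the product of its letters, from left to right). -/
def Word.eval (w : Word) : F := (w.map Letter.val).prod

/-- `w` is a minimum-length word for `f`. -/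
def Word.IsMinimalFor (w : Word) (f : F) : Prop :=
  w.eval = f ∧ ∀ v : Word, v.eval = f → w.length ≤ v.length

/-! ### Binary forests -/

/-- Finite binary trees: `nil` is the trivial tree (a single leaf), and a caret joins the roots of
a left and a right subtree. -/
abbrev BTree : Type := BinaryTree Unit

/-- A binary forest: a sequence of finite binary trees. The pointer is at the tree of index `0`. -/
abbrev BinaryForest : Type := ℤ → BTree

/-- An address `(i, p)`: starting from the root of the `i`-th tree, follow the path `p`, where
`false` means "go to the left child" and `true` means "go to the right child". Ordered
lexicographically. -/
abbrev Address : Type := ℤ ×ₗ List Bool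

/-- The index of the tree of an address. -/
def Address.tree (c : Address) : ℤ := (ofLex c).1

/-- The path of an address. -/
def Address.path (c : Address) : List Bool := (ofLex c).2

/-- The address of the left child. -/
def Address.left (c : Address) : Address := toLex (c.tree, c.path ++ [false])

/-- The address of the right child. -/
def Address.right (c : Address) : Address := toLex (c.tree, c.path ++ [true])

/-- The left endpoint, relative to the interval `[0, 1]`, of the standard dyadic interval with the
given path. -/
def pathStart : List Bool → ℝ
  | [] => 0
  | false :: p => pathStart p / 2
  | true :: p => 1 / 2 + pathStart p / 2

/-- The left endpoint of the standard dyadic interval represented by an address; the root of the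
`i`-th tree represents `[i, i + 1]`, and the children of a node represent the two halves of its
interval. -/
def Address.start (c : Address) : ℝ := c.tree + pathStart c.path

/-- The length of the standard dyadic interval represented by an address. -/
def Address.size (c : Address) : ℝ := (1 / 2) ^ c.path.length

/-- The standard dyadic interval represented by an address. -/
def Address.interval (c : Address) : Set ℝ := Icc c.start (c.start + c.size)

/-- The subtree at the end of a path, if there is one. -/
def subtreeAt : BTree → List Bool → Option BTree
  | T, [] => some T
  | .nil, _ :: _ => none
  | .node _ l _, false :: p => subtreeAt l p
  | .node _ _ r, true :: p => subtreeAt r p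

/-- The address is a leaf of the forest. -/
def BinaryForest.IsLeaf (T : BinaryForest) (c : Address) : Prop :=
  subtreeAt (T c.tree) c.path = some .nil

/-- The carets (internal nodes) of the forest, each given by the address of its top vertex. -/
def BinaryForest.carets (T : BinaryForest) : Set Address :=
  {c | ∃ l r : BTree, subtreeAt (T c.tree) c.path = some (.node () l r)}

/-- The leaves of the forest; the lexicographic order is the order from left to right. -/
abbrev BinaryForest.Leaf (T : BinaryForest) : Type := {c : Address // T.IsLeaf c}

/-- Only finitely many of the trees are nontrivial. -/
def BinaryForest.IsBounded (T : BinaryForest) : Prop := {i : ℤ | T i ≠ .nil}.Finite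

/-- The number of carets of a bounded forest. -/
def BinaryForest.numCarets (T : BinaryForest) : ℕ := ∑ᶠ i : ℤ, (T i).numNodes

/-- Attach a caret to the roots of the `0`-tree and the `1`-tree; afterwards the pointer points to
the new, combined tree. -/
def BinaryForest.attachCaret (T : BinaryForest) : BinaryForest := fun i =>
  if i < 0 then T i else if i = 0 then .node () (T 0) (T 1) else T (i + 1)

/-- Insert a trivial tree immediately to the right of the pointed-to tree. -/
def BinaryForest.insertTrivial (T : BinaryForest) : BinaryForest := fun i =>
  if i ≤ 0 then T i else if i = 1 then .nil else T (i - 1)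

/-! ### Forest diagrams -/

/-- A forest diagram: a pair of bounded binary forests (bottom = domain, top = range), together
with an order-preserving bijection of their leaves. -/
structure ForestDiagram where
  bot : BinaryForest
  top : BinaryForest
  bot_bounded : bot.IsBounded
  top_bounded : top.IsBounded
  leafIso : bot.Leaf ≃o top.Leaf

namespace ForestDiagram

/-- The diagram represents `f`: each interval of the domain subdivision is mapped linearly onto
the corresponding interval of the range subdivision. -/
def Represents (D : ForestDiagram) (f : F) : Prop :=
  ∀ a : D.bot.Leaf, ∀ t ∈ a.1.interval,
    f.1 t = (D.leafIso a).1.start + (D.leafIso a).1.size / a.1.size * (t - a.1.start)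

/-- A bottom caret and a top caret oppose each other if the children of each are leaves and these
leaves correspond to each other. -/
def Opposing (D : ForestDiagram) (b t : Address) : Prop :=
  ∃ l r : D.bot.Leaf, l.1 = b.left ∧ r.1 = b.right ∧
    (D.leafIso l).1 = t.left ∧ (D.leafIso r).1 = t.right

/-- No opposing pairs of carets. -/
def IsReduced (D : ForestDiagram) : Prop := ∀ b t : Address, ¬ D.Opposing b t

/-- `D` is a reduced forest diagram for `f`. -/
def IsReducedFor (D : ForestDiagram) (f : F) : Prop := D.Represents f ∧ D.IsReduced

/-! ### Spaces, labels and weights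

The columns of a diagram are the pairs of corresponding leaves, indexed by the bottom leaf. The
spaces are the gaps between consecutive columns; a space is indexed by the column immediately to
its right. -/

/-- The column lies below or above a nontrivial tree or a tree indicated by a pointer. -/
def IsMarked (D : ForestDiagram) (a : D.bot.Leaf) : Prop :=
  a.1.tree = 0 ∨ (D.leafIso a).1.tree = 0 ∨
    D.bot a.1.tree ≠ .nil ∨ D.top (D.leafIso a).1.tree ≠ .nil

/-- The spaces in the support of the diagram, i.e. in the minimum interval containing both
pointers and all nontrivial trees. -/
def supportSpaces (D : ForestDiagram) : Set D.bot.Leaf :=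
  {a | (∃ b, b < a ∧ D.IsMarked b) ∧ ∃ b, a ≤ b ∧ D.IsMarked b}

end ForestDiagram

/-- The labels of spaces. -/
inductive SpaceLabel : Type
  | L
  | N
  | R
  | I

/-- The label, in one forest, of the space immediately to the left of the leaf `c`.
The space is exterior (between two different trees) iff `c` is the leftmost leaf of its tree, and
then it is to the left of the pointer iff the tree of `c` has index `≤ 0`. The space lies
immediately to the left of some caret iff `c` is the leftmost leaf of some caret, i.e. iff `c` is
the left child of a caret. -/
def spaceLabel (c : Address) : SpaceLabel :=
  if (∀ b ∈ c.path, b = false) ∧ c.tree ≤ 0 then .L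
  else if c.path.getLast? = some false then .N
  else if ∀ b ∈ c.path, b = false then .R
  else .I

/-- The weight of a space with the given top and bottom labels. -/
def weight : SpaceLabel → SpaceLabel → ℕ
  | .L, .L => 2
  | .L, _ => 1
  | _, .L => 1
  | .N, _ => 2
  | _, .N => 2
  | .R, .R => 2
  | .R, .I => 0
  | .I, .R => 0
  | .I, .I => 0

namespace ForestDiagram

/-- `ℓ₀`: the sum of the weights of all spaces in the support. -/
def ell₀ (D : ForestDiagram) : ℕ :=
  ∑ᶠ a ∈ D.supportSpaces, weight (spaceLabel (D.leafIso a).1) (spaceLabel a.1)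

/-- `ℓ₁`: the total number of carets. -/
def ell₁ (D : ForestDiagram) : ℕ := D.top.numCarets + D.bot.numCarets

end ForestDiagram

/-! ### Creation of carets -/

/-- The top caret at address `c` of a diagram for `g` and the top caret at address `d` of a diagram
for `h` are the same caret, i.e. their left children span the same part of the (domain) line and so
do their right children. A top vertex of a diagram for `g` representing the range interval `J`
spans the part `g⁻¹(J)` of the domain. Left multiplications move top carets to other addresses, but
do not affect the part of the domain they span. -/
def SameTopCaret (g : F) (c : Address) (h : F) (d : Address) : Prop :=
  g.1 ⁻¹' c.left.interval = h.1 ⁻¹' d.left.interval ∧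
    g.1 ⁻¹' c.right.interval = h.1 ⁻¹' d.right.interval

/-- Left multiplication of `g` by `x₁` creates a top caret of the diagram `D` of `f`: the reduced
diagram `E'` of `x₁ g` is obtained from the reduced diagram `E` of `g` by attaching a caret to the
roots of the `0`-tree and the `1`-tree of the top forest (no bottom caret is cancelled), and the new
caret, at the root of the `0`-tree, is one of the top carets of `D`. -/
def CreatesTopCaret (f : F) (D : ForestDiagram) (g : F) : Prop :=
  ∃ E E' : ForestDiagram, E.IsReducedFor g ∧ E'.IsReducedFor (x₁ * g) ∧
    E'.bot = E.bot ∧ E'.top = E.top.attachCaret ∧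
    ∃ d ∈ D.top.carets, SameTopCaret (x₁ * g) (toLex (0, [])) f d

/-- Left multiplication of `g` by `x₁⁻¹` creates a bottom caret of the diagram `D`: the current tree
of the reduced diagram `E` of `g` is trivial (its root is a leaf), and the reduced diagram `E'` of
`x₁⁻¹ g` is obtained from `E` by attaching a caret to the bottom leaf `a` under the top pointer and
inserting a trivial tree in the top forest to the right of the pointer; moreover the new caret is
one of the bottom carets of `D`. (Bottom carets are identified by the part of the domain line they
span, i.e. by their address.) -/
def CreatesBottomCaret (D : ForestDiagram) (g : F) : Prop :=
  ∃ E E' : ForestDiagram, E.IsReducedFor g ∧ E'.IsReducedFor (x₁⁻¹ * g) ∧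
    ∃ a : E.bot.Leaf, (E.leafIso a).1 = toLex (0, []) ∧
      E'.bot.carets = insert a.1 E.bot.carets ∧ E'.top = E.top.insertTrivial ∧
      a.1 ∈ D.bot.carets

/-- `w` is a minimum-length word for `f` in which each instance of `x₁` creates a top caret of `D`
and each instance of `x₁⁻¹` creates a bottom caret of `D`. The element is built up from the
identity by left multiplications, that is, the word is read from right to left: an instance of a
letter acts on the element represented by the part of the word to its right. -/
structure IsCreatingWord (f : F) (D : ForestDiagram) (w : Word) : Prop where
  minimal : w.IsMinimalFor f
  top : ∀ u v : Word, w = u ++ Letter.x1 :: v → CreatesTopCaret f D v.eval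
  bot : ∀ u v : Word, w = u ++ Letter.x1inv :: v → CreatesBottomCaret D v.eval

end

end ThompsonF

namespace ThompsonF

open Set Filter

noncomputable section

/-! ### Addresses and their intervals -/

/-! Call a vertex, that is, a standard dyadic interval, regular for `f` if `f` maps it linearly onto
a standard dyadic interval. Regularity passes to descendants, holds at all sufficient depths
(`eventually_reg`) and at almost all roots (`finite_not_reg_root`), so the irregular vertices are
the carets of a bounded forest. A reduced diagram has no regular caret, because an exposed caret
below it would belong to an opposing pair. Its caret sets are therefore forced to be `(Reg f)ᶜ` and
`(Reg f⁻¹)ᶜ` (`carets_of_isReducedFor`). This gives existence and uniqueness, and makes weights and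
caret counts functions of `f` alone.

Let `len` be the sum of the weights and the number of carets. It is the word length for two reasons.
A letter changes `len` by at most one (`len_letter_mul`): `x₀` moves the top pointer, and `x₁`
either joins two top trees or cancels an opposing pair. A move or a join affects only the space
between the top trees 0 and 1, so the weight table decides; a cancellation removes a space of weight
zero. Conversely every `f ≠ 1` has a letter leading to a shorter element (`exists_descent`): either
the root caret of the current tree can be undone, or the pointer can be moved, or an opposing pair
of carets can be produced and cancelled.

The descent is chosen so that, read backwards, each `x₁^{±1}` creates a caret (`Ascends`). Later
ascending letters do not destroy carets, so concatenating the steps gives a creating word of length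
`len f` (`exists_word`). In any creating word each `x₁^{±1}` adds exactly one caret and `x₀^{±1}`
adds none (`IsCreatingWord.count_eq`); together with minimality this fixes both letter counts. -/

theorem pathStart_append (p q : List Bool) :
    pathStart (p ++ q) = pathStart p + (1 / 2) ^ p.length * pathStart q := by
  induction p with
  | nil => simp [pathStart]
  | cons b p ih =>
    cases b <;> simp only [List.cons_append, pathStart, ih, List.length_cons, pow_succ] <;> ring

theorem pathStart_nonneg (p : List Bool) : 0 ≤ pathStart p := by
  induction p with
  | nil => simp [pathStart]
  | cons b p ih => cases b <;> simp only [pathStart] <;> linarith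

theorem pathStart_add_le (p : List Bool) : pathStart p + (1 / 2) ^ p.length ≤ 1 := by
  induction p with
  | nil => simp [pathStart]
  | cons b p ih =>
    cases b <;> simp only [pathStart, List.length_cons, pow_succ] <;> linarith

/-- The lexicographic order looks at the first differing digit. Unless `p` is a prefix, that digit
is `false` in `p` and `true` in `q`, so the intervals lie on opposite sides of a midpoint. -/
theorem pathStart_of_lt {p q : List Bool} (h : p < q) :
    p <+: q ∨ pathStart p + (1 / 2) ^ p.length ≤ pathStart q := by
  induction p generalizing q with
  | nil => exact Or.inl (List.nil_prefix)
  | cons b p ih =>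
    cases q with
    | nil => simp at h
    | cons d q =>
      rw [List.cons_lt_cons_iff] at h
      rcases h with h | ⟨rfl, h⟩
      · obtain ⟨rfl, rfl⟩ : b = false ∧ d = true := by
          revert h; cases b <;> cases d <;> simp
        right
        have h1 := pathStart_add_le p
        have h2 := pathStart_nonneg q
        simp only [pathStart, List.length_cons, pow_succ]
        linarith
      · rcases ih h with h | h
        · left; simpa using h
        · right
          cases b <;> simp only [pathStart, List.length_cons, pow_succ] <;> linarith

namespace Address

/-- The descendant of `c` reached by following the path `q`. -/
def desc (c : Address) (q : List Bool) : Address := toLex (c.tree, c.path ++ q)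

theorem mk_eq {c d : Address} (h1 : c.tree = d.tree) (h2 : c.path = d.path) : c = d :=
  congrArg toLex (Prod.ext h1 h2)

@[simp] theorem tree_mk (i : ℤ) (p : List Bool) : Address.tree (toLex (i, p)) = i := rfl
@[simp] theorem path_mk (i : ℤ) (p : List Bool) : Address.path (toLex (i, p)) = p := rfl
@[simp] theorem tree_desc (c : Address) (q : List Bool) : (c.desc q).tree = c.tree := rfl
@[simp] theorem path_desc (c : Address) (q : List Bool) : (c.desc q).path = c.path ++ q := rfl
@[simp] theorem tree_left (c : Address) : c.left.tree = c.tree := rfl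
@[simp] theorem path_left (c : Address) : c.left.path = c.path ++ [false] := rfl
@[simp] theorem tree_right (c : Address) : c.right.tree = c.tree := rfl
@[simp] theorem path_right (c : Address) : c.right.path = c.path ++ [true] := rfl

theorem desc_nil (c : Address) : c.desc [] = c := mk_eq rfl (by simp)

theorem desc_false_cons (c : Address) (q : List Bool) : c.desc (false :: q) = c.left.desc q :=
  mk_eq rfl (by simp)

theorem desc_true_cons (c : Address) (q : List Bool) : c.desc (true :: q) = c.right.desc q :=
  mk_eq rfl (by simp)

theorem lt_iff {c d : Address} :
    c < d ↔ c.tree < d.tree ∨ c.tree = d.tree ∧ c.path < d.path :=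
  Prod.Lex.toLex_lt_toLex (x := ofLex c) (y := ofLex d)

theorem size_pos (c : Address) : 0 < c.size := by unfold size; positivity

theorem start_desc (c : Address) (q : List Bool) :
    (c.desc q).start = c.start + c.size * pathStart q := by
  simp [start, size, pathStart_append]; ring

theorem size_desc (c : Address) (q : List Bool) :
    (c.desc q).size = c.size * (1 / 2) ^ q.length := by
  simp only [size, path_desc, List.length_append, pow_add]

theorem start_left (c : Address) : c.left.start = c.start := by
  rw [show c.left = c.desc [false] from rfl, start_desc]; simp [pathStart]

theorem size_left (c : Address) : c.left.size = c.size / 2 := by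
  rw [show c.left = c.desc [false] from rfl, size_desc]; simp; ring

theorem start_right (c : Address) : c.right.start = c.start + c.size / 2 := by
  rw [show c.right = c.desc [true] from rfl, start_desc]; simp [pathStart]; ring

theorem size_right (c : Address) : c.right.size = c.size / 2 := by
  rw [show c.right = c.desc [true] from rfl, size_desc]; simp; ring

theorem start_bounds (c : Address) : c.tree ≤ c.start ∧ c.start + c.size ≤ c.tree + 1 := by
  have h1 := pathStart_nonneg c.path
  have h2 := pathStart_add_le c.path
  unfold start size
  constructor <;> linarith

theorem of_lt {a b : Address} (h : a < b) :
    (a.tree = b.tree ∧ a.path <+: b.path) ∨ a.start + a.size ≤ b.start := by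
  rcases lt_iff.1 h with h | ⟨h, h'⟩
  · right
    have h1 := (start_bounds a).2
    have h2 := (start_bounds b).1
    have : (a.tree : ℝ) + 1 ≤ b.tree := by exact_mod_cast h
    linarith
  · rcases pathStart_of_lt h' with h' | h'
    · exact Or.inl ⟨h, h'⟩
    · right
      unfold start size
      rw [h]; linarith

theorem eq_desc {a b : Address} (h : a.tree = b.tree) (h' : a.path <+: b.path) :
    ∃ q, b = a.desc q := by
  obtain ⟨q, hq⟩ := h'
  exact ⟨q, mk_eq h.symm (by simp [hq])⟩

theorem start_mono {a b : Address} (h : a ≤ b) : a.start ≤ b.start := by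
  rcases h.eq_or_lt with rfl | h
  · exact le_rfl
  rcases of_lt h with ⟨h1, h2⟩ | h
  · obtain ⟨q, rfl⟩ := eq_desc h1 h2
    rw [start_desc]
    have := mul_nonneg (size_pos a).le (pathStart_nonneg q)
    linarith
  · have := size_pos a
    linarith

theorem lt_of_start_lt {a b : Address} (h : a.start < b.start) : a < b := by
  by_contra hc
  exact absurd (start_mono (not_lt.1 hc)) (not_le.2 h)

theorem eq_of_start_size {a b : Address} (h : a.start = b.start) (h' : a.size = b.size) :
    a = b := by
  have hl : a.path.length = b.path.length :=
    pow_right_injective₀ (by norm_num) (by norm_num) h'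
  have key : ∀ a b : Address, a.start = b.start → a.path.length = b.path.length → ¬ a < b := by
    intro a b h hl hab
    rcases of_lt hab with ⟨h1, h2⟩ | h3
    · have := h2.eq_of_length hl
      exact absurd (mk_eq h1 this) hab.ne
    · have := size_pos a
      linarith
  rcases lt_trichotomy a b with hab | hab | hab
  · exact absurd hab (key a b h hl)
  · exact hab
  · exact absurd hab (key b a h.symm hl.symm)

/-- Every standard dyadic position is the start of an address. -/
theorem exists_of_start (n : ℕ) (z : ℤ) :
    ∃ c : Address, c.start = z / 2 ^ n ∧ c.size = (1 / 2) ^ n := by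
  induction n generalizing z with
  | zero => exact ⟨toLex (z, []), by simp [start, pathStart], by simp [size]⟩
  | succ n ih =>
    -- The required vertex is a child of the one belonging to the quotient `z / 2`; the parity of
    -- `z` selects which child.
    obtain ⟨c, h1, h2⟩ := ih (z / 2)
    rcases Int.emod_two_eq_zero_or_one z with h | h
    · refine ⟨c.left, ?_, ?_⟩
      · have : z = 2 * (z / 2) := by omega
        have : (z : ℝ) = 2 * ((z / 2 : ℤ) : ℝ) := by exact_mod_cast this
        rw [start_left, h1, this, pow_succ]
        field_simp
      · rw [size_left, h2, pow_succ]; ring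
    · refine ⟨c.right, ?_, ?_⟩
      · have : z = 2 * (z / 2) + 1 := by omega
        have : (z : ℝ) = 2 * ((z / 2 : ℤ) : ℝ) + 1 := by exact_mod_cast this
        rw [start_right, h1, h2, this, pow_succ, one_div, inv_pow]
        field_simp
      · rw [size_right, h2, pow_succ]; ring

theorem start_dyadic (c : Address) : IsDyadic c.start := by
  have : ∀ p : List Bool, IsDyadic (pathStart p) := by
    intro p
    have half : ∀ x : ℝ, IsDyadic x → IsDyadic (x / 2) := fun x hx => by
      have := hx.zpow_mul (-1)
      rwa [zpow_neg_one, inv_mul_eq_div] at this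
    induction p with
    | nil => simpa [pathStart] using IsDyadic.intCast 0
    | cons b p ih =>
      cases b
      · exact half _ ih
      · exact IsDyadic.add (by simpa using half _ (IsDyadic.intCast 1)) (half _ ih)
  exact (IsDyadic.intCast _).add (this _)

theorem mem_interval {c : Address} {t : ℝ} :
    t ∈ c.interval ↔ c.start ≤ t ∧ t ≤ c.start + c.size := Iff.rfl

theorem start_mem (c : Address) : c.start ∈ c.interval :=
  ⟨le_rfl, by linarith [size_pos c]⟩

theorem end_mem (c : Address) : c.start + c.size ∈ c.interval :=
  ⟨by linarith [size_pos c], le_rfl⟩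

end Address

/-! ### The action of elements of `F` on standard dyadic intervals -/

/-- `f` maps the interval of `a` linearly onto the interval of `b`. -/
def Maps (f : F) (a b : Address) : Prop :=
  ∀ t ∈ a.interval, f.1 t = b.start + b.size / a.size * (t - a.start)

namespace Maps

variable {f g : F} {a b c : Address}

theorem apply_start (h : Maps f a b) : f.1 a.start = b.start := by
  rw [h _ a.start_mem]; ring

theorem apply_end (h : Maps f a b) : f.1 (a.start + a.size) = b.start + b.size := by
  rw [h _ a.end_mem]
  have := a.size_pos
  field_simp
  ring

theorem unique (h : Maps f a b) (h' : Maps f a c) : b = c := by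
  have h1 : b.start = c.start := h.apply_start.symm.trans h'.apply_start
  have h2 := h.apply_end.symm.trans h'.apply_end
  exact Address.eq_of_start_size h1 (by linarith)

theorem mem (h : Maps f a b) {t : ℝ} (ht : t ∈ a.interval) : f.1 t ∈ b.interval := by
  have h1 := f.1.monotone ht.1
  have h2 := f.1.monotone ht.2
  rw [h.apply_start] at h1
  rw [h.apply_end] at h2
  exact ⟨h1, h2⟩

theorem mul (hf : Maps f b c) (hg : Maps g a b) : Maps (f * g) a c := by
  intro t ht
  change f.1 (g.1 t) = _
  rw [hf _ (hg.mem ht), hg t ht]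
  have := a.size_pos
  have := b.size_pos
  field_simp
  ring

theorem inv (h : Maps f a b) : Maps f⁻¹ b a := by
  intro t ht
  change f.1.symm t = _
  rw [OrderIso.symm_apply_eq]
  have h1 := a.size_pos
  have h2 := b.size_pos
  rw [h]
  · field_simp
    ring
  · have h3 : 0 ≤ t - b.start := by linarith [ht.1]
    have h4 : t - b.start ≤ b.size := by linarith [ht.2]
    refine ⟨?_, ?_⟩
    · have : 0 ≤ a.size / b.size * (t - b.start) := by positivity
      linarith
    · have : a.size / b.size * (t - b.start) ≤ a.size / b.size * b.size := by gcongr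
      rw [div_mul_cancel₀ _ h2.ne'] at this
      linarith

theorem inv_iff : Maps f⁻¹ b a ↔ Maps f a b :=
  ⟨fun h => by simpa using h.inv, inv⟩

theorem injective (h : Maps f a c) (h' : Maps f b c) : a = b := h.inv.unique h'.inv

theorem left (h : Maps f a b) : Maps f a.left b.left := by
  intro t ht
  rw [Address.mem_interval, Address.start_left, Address.size_left] at ht
  rw [h t ⟨ht.1, by linarith [a.size_pos]⟩]
  simp only [Address.start_left, Address.size_left]
  have := a.size_pos
  field_simp

theorem right (h : Maps f a b) : Maps f a.right b.right := by
  intro t ht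
  rw [Address.mem_interval, Address.start_right, Address.size_right] at ht
  rw [h t ⟨by linarith [a.size_pos], by linarith⟩]
  simp only [Address.start_right, Address.size_right]
  have := a.size_pos
  field_simp
  ring

/-- Two linear pieces with the same slope that meet at the midpoint glue. This is why the bottom
caret of an opposing pair is regular. -/
theorem of_children (hl : Maps f a.left b.left) (hr : Maps f a.right b.right) : Maps f a b := by
  intro t ht
  have ha := a.size_pos
  rcases le_total t (a.start + a.size / 2) with h | h
  · rw [hl t (by rw [Address.mem_interval, Address.start_left, Address.size_left]; exact ⟨ht.1, h⟩)]
    simp only [Address.start_left, Address.size_left]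
    field_simp
  · rw [hr t (by
      rw [Address.mem_interval, Address.start_right, Address.size_right]
      exact ⟨h, by linarith [ht.2]⟩)]
    simp only [Address.start_right, Address.size_right]
    field_simp
    ring

theorem desc (h : Maps f a b) (q : List Bool) : Maps f (a.desc q) (b.desc q) := by
  induction q generalizing a b with
  | nil => simpa only [Address.desc_nil] using h
  | cons d q ih =>
    cases d
    · simpa only [Address.desc_false_cons] using ih h.left
    · simpa only [Address.desc_true_cons] using ih h.right

theorem preimage (h : Maps f a b) : f.1 ⁻¹' b.interval = a.interval := by
  ext t
  refine ⟨fun ht => ?_, h.mem⟩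
  have := h.inv.mem ht
  simpa using this

theorem one (a : Address) : Maps 1 a a := by
  intro t _
  have := a.size_pos
  change t = _
  field_simp
  ring

end Maps

/-! ### Regular vertices, and why all but finitely many vertices are regular -/

/-- The address has an interval that is mapped linearly onto a standard dyadic interval. -/
def Reg (f : F) : Set Address := {a | ∃ b, Maps f a b}

theorem Reg.desc {f : F} {a : Address} (h : a ∈ Reg f) (q : List Bool) : a.desc q ∈ Reg f := by
  obtain ⟨b, hb⟩ := h
  exact ⟨_, hb.desc q⟩

theorem Maps.reg {f : F} {a b : Address} (h : Maps f a b) : a ∈ Reg f := ⟨b, h⟩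

theorem Maps.reg_inv {f : F} {a b : Address} (h : Maps f a b) : b ∈ Reg f⁻¹ := ⟨a, h.inv⟩

theorem reg_mul_iff {s g : F} {b b' : Address} (h : Maps s b b') :
    b' ∈ Reg (s * g)⁻¹ ↔ b ∈ Reg g⁻¹ := by
  constructor
  · rintro ⟨a, ha⟩
    refine ⟨a, ?_⟩
    have := ha.mul h
    rwa [mul_inv_rev, inv_mul_cancel_right] at this
  · rintro ⟨a, ha⟩
    exact ⟨a, by rw [mul_inv_rev]; exact ha.mul h.inv⟩

/-- If all sufficiently deep descendants of each depth-`n` descendant of `a` satisfy `P`, then so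
do all sufficiently deep descendants of `a`. -/
theorem eventually_reg_of_depth {P : Address → Prop} (n : ℕ) (a : Address)
    (h : ∀ p : List Bool, p.length = n → ∃ N, ∀ q : List Bool, N ≤ q.length → P ((a.desc p).desc q)) :
    ∃ N, ∀ q : List Bool, N ≤ q.length → P (a.desc q) := by
  induction n generalizing a with
  | zero =>
    obtain ⟨N, hN⟩ := h [] rfl
    exact ⟨N, fun q hq => by simpa only [Address.desc_nil] using hN q hq⟩
  | succ n ih =>
    obtain ⟨N₁, h₁⟩ := ih a.left (fun p hp => by
      simpa only [Address.desc_false_cons] using h (false :: p) (by simp [hp]))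
    obtain ⟨N₂, h₂⟩ := ih a.right (fun p hp => by
      simpa only [Address.desc_true_cons] using h (true :: p) (by simp [hp]))
    refine ⟨max N₁ N₂ + 1, fun q hq => ?_⟩
    cases q with
    | nil => simp at hq
    | cons b q =>
      simp only [List.length_cons, add_le_add_iff_right, max_le_iff] at hq
      cases b
      · rw [Address.desc_false_cons]; exact h₁ q hq.1
      · rw [Address.desc_true_cons]; exact h₂ q hq.2

theorem IsDyadic.exists_mul_pow {x : ℝ} (hx : IsDyadic x) :
    ∃ n : ℕ, ∀ m, n ≤ m → ∃ z : ℤ, x * 2 ^ m = z := by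
  obtain ⟨a, n, rfl⟩ := hx
  refine ⟨n, fun m hm => ⟨a * 2 ^ (m - n), ?_⟩⟩
  obtain ⟨k, rfl⟩ := Nat.exists_eq_add_of_le hm
  push_cast
  rw [add_tsub_cancel_left, pow_add]
  field_simp

theorem exists_common_denominator (B : Finset ℝ) (hB : ∀ b ∈ B, IsDyadic b) :
    ∃ n : ℕ, ∀ b ∈ B, ∃ z : ℤ, b * 2 ^ n = z := by
  have : ∃ n : ℕ, ∀ m, n ≤ m → ∀ b ∈ B, ∃ z : ℤ, b * 2 ^ m = z := by
    induction B using Finset.induction_on with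
    | empty => exact ⟨0, by simp⟩
    | insert b B _ ih =>
      obtain ⟨n₁, h₁⟩ := ih (fun b hb => hB b (Finset.mem_insert_of_mem hb))
      obtain ⟨n₂, h₂⟩ := (hB b (Finset.mem_insert_self _ _)).exists_mul_pow
      refine ⟨max n₁ n₂, fun m hm c hc => ?_⟩
      rcases Finset.mem_insert.1 hc with rfl | hc
      · exact h₂ m (le_of_max_le_right hm)
      · exact h₁ m (le_of_max_le_left hm) c hc
  obtain ⟨n, hn⟩ := this
  exact ⟨n, hn n le_rfl⟩

theorem Address.start_mul_pow (c : Address) : ∃ z : ℤ, c.start * 2 ^ c.path.length = z := by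
  have : ∀ p : List Bool, ∃ z : ℤ, pathStart p * 2 ^ p.length = z := by
    intro p
    induction p with
    | nil => exact ⟨0, by simp [pathStart]⟩
    | cons b p ih =>
      obtain ⟨z, hz⟩ := ih
      cases b
      · exact ⟨z, by rw [← hz]; simp only [pathStart, List.length_cons, pow_succ]; ring⟩
      · refine ⟨2 ^ p.length + z, ?_⟩
        push_cast
        rw [← hz]; simp only [pathStart, List.length_cons, pow_succ]; ring
  obtain ⟨z, hz⟩ := this c.path
  refine ⟨c.tree * 2 ^ c.path.length + z, ?_⟩
  push_cast
  rw [← hz, start]; ring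

/-- An element of `F` is regular on sufficiently deep descendants of every vertex on which it is
linear. -/
theorem eventually_reg_of_linear (f : F) (a : Address) (k : ℤ) (c : ℝ)
    (h : ∀ t ∈ a.interval, f.1 t = (2 : ℝ) ^ k * t + c) :
    ∃ N, ∀ q : List Bool, N ≤ q.length → a.desc q ∈ Reg f := by
  obtain ⟨n, hn⟩ := (IsPL2.dyadic f.2 a.start_dyadic).exists_mul_pow
  set l := a.path.length
  have hk : ((l : ℤ) - k) ≤ (((l : ℤ) - k).toNat : ℤ) := Int.self_le_toNat _
  refine ⟨n + k.natAbs, fun q hq => ?_⟩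
  -- The image of `a.desc q` has length `2^(-m)`. The bound on `q.length` gives `m ≥ n`, so the
  -- image of `a.start` is a multiple of `2^(-m)`, and hence so is the start of the image interval.
  obtain ⟨m, hm⟩ : ∃ m : ℕ, (m : ℤ) = l + q.length - k := ⟨(l + q.length - k).toNat, by omega⟩
  obtain ⟨z₁, hz₁⟩ := hn m (by omega)
  obtain ⟨z₂, hz₂⟩ := Address.start_mul_pow (toLex (0, q))
  have hq' : pathStart q * 2 ^ q.length = z₂ := by simpa [Address.start] using hz₂
  obtain ⟨b, hb₁, hb₂⟩ := Address.exists_of_start m (z₁ + z₂)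
  have e2 : ((2 : ℝ) ^ m) = 2 ^ l * 2 ^ q.length * ((2 : ℝ) ^ k)⁻¹ := by
    rw [← zpow_natCast, hm, zpow_sub₀ (by norm_num), zpow_add₀ (by norm_num)]
    simp [div_eq_mul_inv]
  have hsz : a.size = (2 ^ l)⁻¹ := by simp [Address.size, l]
  have hk0 : (2 : ℝ) ^ k ≠ 0 := by positivity
  refine ⟨b, fun t ht => ?_⟩
  have ht' : t ∈ a.interval := by
    rw [Address.mem_interval, Address.start_desc, Address.size_desc] at ht
    have h1 := mul_nonneg a.size_pos.le (pathStart_nonneg q)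
    have h2 := mul_le_mul_of_nonneg_left (pathStart_add_le q) a.size_pos.le
    exact ⟨by linarith [ht.1], by linarith [ht.2]⟩
  have e1 := h _ a.start_mem
  have hs1 : b.start = f.1 a.start + (2 : ℝ) ^ k * (a.size * pathStart q) := by
    rw [hb₁, div_eq_iff (by positivity)]
    push_cast
    rw [← hz₁, ← hq', hsz, add_mul, e2]
    field_simp
  have hs2 : b.size = (2 : ℝ) ^ k * (a.desc q).size := by
    rw [hb₂, one_div, inv_pow, e2, Address.size_desc, hsz]
    simp only [one_div, inv_pow, mul_inv, inv_inv]
    ring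
  have := (a.desc q).size_pos
  rw [hs2, mul_div_cancel_right₀ _ this.ne', hs1, e1, Address.start_desc, h t ht']
  ring

/-- Beyond the common denominator of the breakpoints no breakpoint is interior to a vertex, so `f`
is linear there and the linear case applies. -/
theorem eventually_reg (f : F) (a : Address) :
    ∃ N, ∀ q : List Bool, N ≤ q.length → a.desc q ∈ Reg f := by
  obtain ⟨B, hB, hp⟩ := f.2.pieces
  obtain ⟨n, hn⟩ := exists_common_denominator B (fun b hb => (hB b hb).1)
  refine eventually_reg_of_depth (P := (· ∈ Reg f)) n a (fun p hlen => ?_)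
  set c := a.desc p with hc
  obtain ⟨k, d, h⟩ := hp c.start (c.start + c.size) (by linarith [c.size_pos]) (by
    intro t ht htB
    obtain ⟨z, hz⟩ := hn t htB
    obtain ⟨y, hy⟩ := c.start_mul_pow
    have hl : c.path.length = a.path.length + n := by simp [hc, hlen]
    have h2 : (0 : ℝ) < 2 ^ c.path.length := by positivity
    have e : c.size * 2 ^ c.path.length = 1 := by simp [Address.size]
    -- In units of `c.size`, a breakpoint inside `c` would be an integer strictly between two
    -- consecutive integers.
    have e' : t * 2 ^ c.path.length = ((z * 2 ^ a.path.length : ℤ) : ℝ) := by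
      push_cast
      rw [← hz, hl, pow_add]; ring
    have h3 := mul_lt_mul_of_pos_right ht.1 h2
    have h4 := mul_lt_mul_of_pos_right ht.2 h2
    rw [add_mul, e, hy, e'] at h4
    rw [hy, e'] at h3
    have h3' : y < z * 2 ^ a.path.length := by exact_mod_cast h3
    have h4' : z * 2 ^ a.path.length < y + 1 := by exact_mod_cast h4
    omega)
  exact eventually_reg_of_linear f c k d h

/-- Near both ends `f` is an integer translation and carries unit intervals to unit intervals; only
the roots between the two thresholds remain. -/
theorem finite_not_reg_root (f : F) : {i : ℤ | toLex (i, []) ∉ Reg f}.Finite := by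
  obtain ⟨m, hm⟩ := f.2.left_end
  obtain ⟨n, hn⟩ := f.2.right_end
  obtain ⟨A, hA⟩ := eventually_atBot.mp hm
  obtain ⟨C, hC⟩ := eventually_atTop.mp hn
  refine (Set.finite_Icc (⌊A⌋ - 1) ⌈C⌉).subset (fun i hi => ?_)
  have tr : ∀ k : ℤ, (∀ t : ℝ, t ∈ Address.interval (toLex (i, [])) → f.1 t = t - k) →
      toLex (i, []) ∈ Reg f := by
    intro k hk
    refine ⟨toLex (i - k, []), fun t ht => ?_⟩
    rw [hk t ht]
    simp [Address.start, Address.size, pathStart]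
  change _ ∉ _ at hi
  constructor
  · by_contra h
    refine hi (tr m fun t ht => hA t ?_)
    have h1 := ht.2
    simp [Address.start, Address.size, pathStart] at h1
    have h2 : (i : ℝ) + 1 ≤ ⌊A⌋ := by
      have : i + 1 ≤ ⌊A⌋ := by omega
      exact_mod_cast this
    linarith [Int.floor_le A]
  · by_contra h
    refine hi (tr n fun t ht => hC t ?_)
    have h1 := ht.1
    simp [Address.start, pathStart] at h1
    have h2 : (⌈C⌉ : ℝ) ≤ i := by
      have : ⌈C⌉ ≤ i := by omega
      exact_mod_cast this
    linarith [Int.le_ceil C]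

/-! ### Trees and forests are determined by their carets -/

/-- The path leads to a caret of the tree. -/
def IsCaret (T : BTree) (p : List Bool) : Prop :=
  ∃ l r : BTree, subtreeAt T p = some (.node () l r)

@[simp] theorem subtreeAt_nil (T : BTree) : subtreeAt T [] = some T := by cases T <;> rfl

theorem not_isCaret_nil (p : List Bool) : ¬ IsCaret .nil p := by
  rintro ⟨l, r, h⟩
  cases p <;> simp [subtreeAt] at h

@[simp] theorem isCaret_node_nil (u : Unit) (l r : BTree) : IsCaret (.node u l r) [] :=
  ⟨l, r, by simp⟩

@[simp] theorem isCaret_node_false (u : Unit) (l r : BTree) (p : List Bool) :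
    IsCaret (.node u l r) (false :: p) ↔ IsCaret l p := Iff.rfl

@[simp] theorem isCaret_node_true (u : Unit) (l r : BTree) (p : List Bool) :
    IsCaret (.node u l r) (true :: p) ↔ IsCaret r p := Iff.rfl

theorem isCaret_nil_iff {T : BTree} : IsCaret T [] ↔ T ≠ .nil := by
  cases T with
  | nil => simp [not_isCaret_nil]
  | node u l r => simp

theorem tree_ext {T T' : BTree} (h : ∀ p, IsCaret T p ↔ IsCaret T' p) : T = T' := by
  induction T generalizing T' with
  | nil =>
    by_contra hc
    exact not_isCaret_nil [] ((h []).2 (isCaret_nil_iff.2 (Ne.symm hc)))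
  | node u l r ihl ihr =>
    cases T' with
    | nil => exact absurd ((h []).1 (by simp)) (not_isCaret_nil [])
    | node u' l' r' =>
      rw [ihl (fun p => h (false :: p)), ihr (fun p => h (true :: p))]

theorem isCaret_of_append {T : BTree} {p q : List Bool} (h : IsCaret T (p ++ q)) :
    IsCaret T p := by
  induction T generalizing p with
  | nil => exact absurd h (not_isCaret_nil _)
  | node u l r ihl ihr =>
    match p with
    | [] => simp
    | false :: p => exact ihl h
    | true :: p => exact ihr h

/-- Describes leaves through carets alone, so that the leaves of the forest of irregular vertices
become the maximal regular vertices. -/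
theorem subtreeAt_eq_nil_iff {T : BTree} {p : List Bool} :
    subtreeAt T p = some .nil ↔ ¬ IsCaret T p ∧ ∀ q b, p = q ++ [b] → IsCaret T q := by
  induction T generalizing p with
  | nil =>
    match p with
    | [] => simp [not_isCaret_nil]
    | b :: p =>
      simp only [subtreeAt, reduceCtorEq, false_iff, not_and, not_forall]
      exact fun _ => ⟨(b :: p).dropLast, (b :: p).getLast (by simp),
        (List.dropLast_append_getLast _).symm, not_isCaret_nil _⟩
  | node u l r ihl ihr =>
    match p with
    | [] => simp
    | false :: p =>
      rw [show subtreeAt (.node u l r) (false :: p) = subtreeAt l p from rfl, ihl,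
        isCaret_node_false]
      refine and_congr_right fun _ => ⟨fun h q b hq => ?_, fun h q b hq => ?_⟩
      · match q with
        | [] => simp
        | d :: q =>
          obtain ⟨rfl, rfl⟩ := List.cons_eq_cons.1 hq
          exact h q b rfl
      · exact h (false :: q) b (by simp [hq])
    | true :: p =>
      rw [show subtreeAt (.node u l r) (true :: p) = subtreeAt r p from rfl, ihr,
        isCaret_node_true]
      refine and_congr_right fun _ => ⟨fun h q b hq => ?_, fun h q b hq => ?_⟩
      · match q with
        | [] => simp
        | d :: q =>
          obtain ⟨rfl, rfl⟩ := List.cons_eq_cons.1 hq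
          exact h q b rfl
      · exact h (true :: q) b (by simp [hq])

theorem exists_leaf_above {T : BTree} {p : List Bool} (h : ¬ IsCaret T p) :
    ∃ q s, p = q ++ s ∧ subtreeAt T q = some .nil := by
  induction T generalizing p with
  | nil => exact ⟨[], p, rfl, by simp⟩
  | node u l r ihl ihr =>
    match p with
    | [] => simp at h
    | false :: p =>
      obtain ⟨q, s, rfl, hq⟩ := ihl (p := p) h
      exact ⟨false :: q, s, rfl, hq⟩
    | true :: p =>
      obtain ⟨q, s, rfl, hq⟩ := ihr (p := p) h
      exact ⟨true :: q, s, rfl, hq⟩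

/-- Descend as long as some child is nontrivial; in a finite tree this stops at a caret whose
children are both leaves. -/
theorem exists_exposed_caret {T : BTree} {p : List Bool} (h : IsCaret T p) :
    ∃ s, subtreeAt T (p ++ s ++ [false]) = some .nil ∧
      subtreeAt T (p ++ s ++ [true]) = some .nil := by
  induction T generalizing p with
  | nil => exact absurd h (not_isCaret_nil _)
  | node u l r ihl ihr =>
    match p with
    | [] =>
      by_cases hl : l = .nil
      · by_cases hr : r = .nil
        · exact ⟨[], by simp [subtreeAt, hl, hr]⟩
        · obtain ⟨s, h1, h2⟩ := ihr (isCaret_nil_iff.2 hr)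
          exact ⟨true :: s, h1, h2⟩
      · obtain ⟨s, h1, h2⟩ := ihl (isCaret_nil_iff.2 hl)
        exact ⟨false :: s, h1, h2⟩
    | false :: p => exact ihl h
    | true :: p => exact ihr h

theorem setOf_isCaret_node (u : Unit) (l r : BTree) :
    {p | IsCaret (.node u l r) p} =
      insert [] ((false :: ·) '' {p | IsCaret l p} ∪ (true :: ·) '' {p | IsCaret r p}) := by
  ext p
  match p with
  | [] => simp
  | false :: p => simp
  | true :: p => simp

theorem finite_isCaret (T : BTree) : {p | IsCaret T p}.Finite := by
  induction T with
  | nil => simp [not_isCaret_nil]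
  | node u l r ihl ihr =>
    rw [setOf_isCaret_node]
    exact ((ihl.image _).union (ihr.image _)).insert _

theorem ncard_isCaret (T : BTree) : {p | IsCaret T p}.ncard = T.numNodes := by
  induction T with
  | nil => simp [not_isCaret_nil, BinaryTree.numNodes]
  | node u l r ihl ihr =>
    have hl := (finite_isCaret l).image (false :: ·)
    have hr := (finite_isCaret r).image (true :: ·)
    rw [setOf_isCaret_node, ncard_insert_of_notMem (by simp) (hl.union hr),
      ncard_union_eq ?_ hl hr, ncard_image_of_injective _ (List.cons_injective),
      ncard_image_of_injective _ (List.cons_injective), ihl, ihr, BinaryTree.numNodes]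
    rw [Set.disjoint_left]
    rintro _ ⟨p, _, rfl⟩ ⟨q, _, h⟩
    simp at h

/-- The binary tree of depth at most `n` whose carets are the paths violating `P`. -/
def treeOf (P : List Bool → Prop) : ℕ → BTree
  | 0 => .nil
  | n + 1 =>
    open Classical in
    if P [] then .nil
    else .node () (treeOf (fun p => P (false :: p)) n) (treeOf (fun p => P (true :: p)) n)

/-- By `hP` the paths violating `P` are closed under prefixes, hence form a tree; by `hn` cutting it
off at depth `n` loses nothing. -/
theorem isCaret_treeOf {P : List Bool → Prop} {n : ℕ} (hP : ∀ p q, P p → P (p ++ q))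
    (hn : ∀ p, n ≤ p.length → P p) (p : List Bool) : IsCaret (treeOf P n) p ↔ ¬ P p := by
  induction n generalizing P p with
  | zero => simp [treeOf, not_isCaret_nil, hn]
  | succ n ih =>
    rw [treeOf]
    split_ifs with h
    · simp [not_isCaret_nil, show P p from hP [] p h]
    · match p with
      | [] => simp [h]
      | false :: p =>
        exact ih (P := fun p => P (false :: p)) (fun p q => hP (false :: p) q)
          (fun p hp => hn _ (by simpa using hp)) p
      | true :: p =>
        exact ih (P := fun p => P (true :: p)) (fun p q => hP (true :: p) q)
          (fun p hp => hn _ (by simpa using hp)) p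

namespace BinaryForest

theorem mem_carets {T : BinaryForest} {c : Address} :
    c ∈ T.carets ↔ IsCaret (T c.tree) c.path := Iff.rfl

theorem ext_carets {T T' : BinaryForest} (h : T.carets = T'.carets) : T = T' := by
  funext i
  exact tree_ext fun p => Set.ext_iff.1 h (toLex (i, p))

theorem isLeaf_iff {T : BinaryForest} {c : Address} :
    T.IsLeaf c ↔ c ∉ T.carets ∧ ∀ q b, c.path = q ++ [b] → toLex (c.tree, q) ∈ T.carets :=
  subtreeAt_eq_nil_iff

theorem exists_leaf_above {T : BinaryForest} {c : Address} (h : c ∉ T.carets) :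
    ∃ d s, T.IsLeaf d ∧ c = d.desc s := by
  obtain ⟨q, s, h1, h2⟩ := ThompsonF.exists_leaf_above h
  exact ⟨toLex (c.tree, q), s, h2, Address.mk_eq rfl h1⟩

theorem exists_exposed_caret {T : BinaryForest} {c : Address} (h : c ∈ T.carets) :
    ∃ s, T.IsLeaf (c.desc s).left ∧ T.IsLeaf (c.desc s).right := by
  obtain ⟨s, h1, h2⟩ := ThompsonF.exists_exposed_caret h
  exact ⟨s, h1, h2⟩

theorem carets_eq_iUnion (T : BinaryForest) :
    T.carets = ⋃ i ∈ {i | T i ≠ .nil}, (fun p => toLex (i, p)) '' {p | IsCaret (T i) p} := by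
  ext c
  simp only [mem_iUnion, mem_image]
  constructor
  · intro h
    exact ⟨c.tree, isCaret_nil_iff.1 (isCaret_of_append (p := []) h), c.path, h, rfl⟩
  · rintro ⟨i, _, p, hp, rfl⟩
    exact hp

theorem finite_carets {T : BinaryForest} (hT : T.IsBounded) : T.carets.Finite := by
  rw [carets_eq_iUnion]
  exact hT.biUnion fun i _ => (finite_isCaret _).image _

theorem numCarets_eq {T : BinaryForest} (hT : T.IsBounded) : T.numCarets = T.carets.ncard := by
  have hinj : ∀ i : ℤ, Function.Injective (fun p : List Bool => (toLex (i, p) : Address)) := by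
    intro i p q h
    simpa using congrArg Address.path h
  rw [carets_eq_iUnion, hT.ncard_biUnion (fun i _ => (finite_isCaret _).image _)]
  · simp only [ncard_image_of_injective _ (hinj _), ncard_isCaret]
    refine finsum_congr fun i => ?_
    by_cases h : T i = .nil
    · simp [h, BinaryTree.numNodes]
    · simp [h]
  · intro i _ j _ hij
    rw [Function.onFun, Set.disjoint_left]
    rintro _ ⟨p, _, rfl⟩ ⟨q, _, h⟩
    exact hij (by simpa using (congrArg Address.tree h).symm)

theorem isBounded_of_finite {T : BinaryForest} (h : {i : ℤ | toLex (i, []) ∈ T.carets}.Finite) :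
    T.IsBounded :=
  h.subset fun _ hi => isCaret_nil_iff.2 hi

theorem mem_carets_attachCaret {T : BinaryForest} {i : ℤ} {p : List Bool} :
    toLex (i, p) ∈ T.attachCaret.carets ↔
      if i < 0 then toLex (i, p) ∈ T.carets
      else if i = 0 then p = [] ∨ (∃ q, p = false :: q ∧ toLex (0, q) ∈ T.carets) ∨
        ∃ q, p = true :: q ∧ toLex (1, q) ∈ T.carets
      else toLex (i + 1, p) ∈ T.carets := by
  simp only [mem_carets, Address.tree_mk, Address.path_mk]
  split_ifs with h1 h2
  · simp [attachCaret, h1]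
  · subst h2
    match p with
    | [] => simp [attachCaret]
    | false :: p => simp [attachCaret]
    | true :: p => simp [attachCaret]
  · simp [attachCaret, h1, h2]

theorem mem_carets_insertTrivial {T : BinaryForest} {i : ℤ} {p : List Bool} :
    toLex (i, p) ∈ T.insertTrivial.carets ↔
      if i ≤ 0 then toLex (i, p) ∈ T.carets
      else i ≠ 1 ∧ toLex (i - 1, p) ∈ T.carets := by
  simp only [mem_carets, Address.tree_mk, Address.path_mk]
  split_ifs with h1
  · simp [insertTrivial, h1]
  · by_cases h2 : i = 1
    · simp [insertTrivial, h2, not_isCaret_nil]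
    · simp [insertTrivial, h1, h2]

end BinaryForest

/-! ### The reduced forest diagram of an element -/

/-- The forest whose carets are the vertices that are not regular for `f`. -/
def regForest (f : F) : BinaryForest := fun i =>
  treeOf (fun p => toLex (i, p) ∈ Reg f) (eventually_reg f (toLex (i, []))).choose

theorem carets_regForest (f : F) : (regForest f).carets = (Reg f)ᶜ := by
  ext c
  exact isCaret_treeOf (P := fun p => toLex (c.tree, p) ∈ Reg f)
    (fun p q h => Reg.desc h q)
    (fun p hp => (eventually_reg f (toLex (c.tree, []))).choose_spec p hp) c.path

theorem regForest_isBounded (f : F) : (regForest f).IsBounded :=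
  BinaryForest.isBounded_of_finite (by rw [carets_regForest]; exact finite_not_reg_root f)

/-- The maximal regular vertices for `f`, i.e. the bottom leaves of its reduced diagram. -/
def IsCol (f : F) (a : Address) : Prop :=
  a ∈ Reg f ∧ ∀ q b, a.path = q ++ [b] → toLex (a.tree, q) ∉ Reg f

theorem isLeaf_regForest {f : F} {a : Address} : (regForest f).IsLeaf a ↔ IsCol f a := by
  rw [BinaryForest.isLeaf_iff, carets_regForest]
  simp [IsCol]

namespace IsCol

variable {f : F} {a b c : Address}

theorem reg (h : IsCol f a) : a ∈ Reg f := h.1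

theorem eq_of_desc (h : IsCol f (c.desc q)) (hc : c ∈ Reg f) : q = [] := by
  rcases q.eq_nil_or_concat with rfl | ⟨q', b, rfl⟩
  · rfl
  · exact absurd (Reg.desc hc q') (h.2 (c.path ++ q') b (by simp))

theorem eq_of_prefix (ha : IsCol f a) (hb : IsCol f b) (h1 : a.tree = b.tree)
    (h2 : a.path <+: b.path) : a = b := by
  obtain ⟨q, rfl⟩ := Address.eq_desc h1 h2
  rw [hb.eq_of_desc ha.reg, Address.desc_nil]

theorem end_le (ha : IsCol f a) (hb : IsCol f b) (h : a < b) : a.start + a.size ≤ b.start := by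
  rcases Address.of_lt h with ⟨h1, h2⟩ | h'
  · exact absurd (ha.eq_of_prefix hb h1 h2) h.ne
  · exact h'

theorem start_lt (ha : IsCol f a) (hb : IsCol f b) (h : a < b) : a.start < b.start := by
  have := ha.end_le hb h
  linarith [a.size_pos]

/-- The image of a column is a column of the inverse. -/
theorem image (ha : IsCol f a) (h : Maps f a b) : IsCol f⁻¹ b := by
  refine ⟨h.reg_inv, fun q d hq hr => ?_⟩
  obtain ⟨c, hc⟩ := hr
  have hc := Maps.inv_iff.1 hc
  have e : b = Address.desc (toLex (b.tree, q)) [d] := Address.mk_eq rfl (by simpa using hq)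
  rw [e] at h
  have : a = c.desc [d] := h.injective (hc.desc [d])
  subst this
  simpa using ha.eq_of_desc hc.reg

theorem image_lt {a' b' : Address} (ha : IsCol f a) (hb : IsCol f b) (h : a < b)
    (h1 : Maps f a a') (h2 : Maps f b b') : a' < b' := by
  have := f.1.strictMono (ha.start_lt hb h)
  rw [h1.apply_start, h2.apply_start] at this
  exact Address.lt_of_start_lt this

end IsCol

/-- Every vertex is either a proper ancestor of a column or a descendant of one. -/
theorem exists_isCol_above {f : F} {c : Address} (h : c ∈ Reg f) :
    ∃ d s, IsCol f d ∧ c = d.desc s := by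
  obtain ⟨d, s, h1, h2⟩ := (regForest f).exists_leaf_above (c := c)
    (by rw [carets_regForest]; simpa using h)
  exact ⟨d, s, isLeaf_regForest.1 h1, h2⟩

open Classical in
/-- The vertex onto which `f` maps a regular vertex. -/
def img (f : F) (a : Address) : Address := if h : ∃ b, Maps f a b then h.choose else a

theorem maps_img {f : F} {a : Address} (h : a ∈ Reg f) : Maps f a (img f a) := by
  have h' : ∃ b, Maps f a b := h
  rw [img, dif_pos h']
  exact h'.choose_spec

theorem Maps.img_eq {f : F} {a b : Address} (h : Maps f a b) : img f a = b :=
  (maps_img h.reg).unique h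

theorem IsCol.maps {f : F} {a : Address} (h : IsCol f a) : Maps f a (img f a) := maps_img h.reg

/-- The order isomorphism between the leaves of the reduced diagram. -/
def regLeafIso (f : F) : (regForest f).Leaf ≃o (regForest f⁻¹).Leaf :=
  StrictMono.orderIsoOfSurjective
    (fun a => ⟨img f a.1, isLeaf_regForest.2
      ((isLeaf_regForest.1 a.2).image (isLeaf_regForest.1 a.2).maps)⟩)
    (fun a b h => (isLeaf_regForest.1 a.2).image_lt (isLeaf_regForest.1 b.2) h
      (isLeaf_regForest.1 a.2).maps (isLeaf_regForest.1 b.2).maps)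
    (fun b => by
      have hb := isLeaf_regForest.1 b.2
      have h := hb.maps
      have := hb.image h
      rw [inv_inv] at this
      exact ⟨⟨_, isLeaf_regForest.2 this⟩, Subtype.ext (Maps.inv_iff.1 h).img_eq⟩)

/-- The reduced forest diagram of `f`. -/
def diagram (f : F) : ForestDiagram where
  bot := regForest f
  top := regForest f⁻¹
  bot_bounded := regForest_isBounded f
  top_bounded := regForest_isBounded f⁻¹
  leafIso := regLeafIso f

theorem ForestDiagram.Represents.maps {D : ForestDiagram} {f : F} (h : D.Represents f)
    (a : D.bot.Leaf) : Maps f a.1 (D.leafIso a).1 := h a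

theorem diagram_represents (f : F) : (diagram f).Represents f := fun a =>
  (isLeaf_regForest.1 a.2).maps

theorem diagram_isReducedFor (f : F) : (diagram f).IsReducedFor f := by
  refine ⟨diagram_represents f, ?_⟩
  rintro b t ⟨l, r, h1, h2, h3, h4⟩
  have hl := (diagram_represents f).maps l
  have hr := (diagram_represents f).maps r
  rw [h1, h3] at hl
  rw [h2, h4] at hr
  have := isLeaf_regForest.1 l.2
  exact this.2 b.path false (by rw [h1]; rfl) (by rw [h1]; exact (hl.of_children hr).reg)

/-- Below a regular caret there is an exposed regular caret, and its leaf children are sent to the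
two children of its image: an opposing pair. Conversely, a vertex that is not a caret lies at or
below a leaf, and leaves are regular because the diagram represents `f`. -/
theorem carets_of_isReducedFor {f : F} {E : ForestDiagram} (h : E.IsReducedFor f) :
    E.bot.carets = (Reg f)ᶜ ∧ E.top.carets = (Reg f⁻¹)ᶜ := by
  obtain ⟨hr, hred⟩ := h
  constructor
  · ext c
    constructor
    · rintro hc hreg
      obtain ⟨s, h1, h2⟩ := E.bot.exists_exposed_caret hc
      obtain ⟨b, hb⟩ := Reg.desc hreg s
      exact hred _ b ⟨⟨_, h1⟩, ⟨_, h2⟩, rfl, rfl, (hr.maps ⟨_, h1⟩).unique hb.left,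
        (hr.maps ⟨_, h2⟩).unique hb.right⟩
    · intro hc
      by_contra hn
      obtain ⟨d, s, h1, rfl⟩ := E.bot.exists_leaf_above hn
      exact hc (Reg.desc (hr.maps ⟨d, h1⟩).reg s)
  · ext c
    constructor
    · rintro hc hreg
      obtain ⟨s, h1, h2⟩ := E.top.exists_exposed_caret hc
      obtain ⟨b, hb⟩ := Reg.desc hreg s
      have hl := hr.maps (E.leafIso.symm ⟨_, h1⟩)
      have hr' := hr.maps (E.leafIso.symm ⟨_, h2⟩)
      rw [E.leafIso.apply_symm_apply] at hl hr'
      exact hred b _ ⟨_, _, hl.inv.unique hb.left, hr'.inv.unique hb.right,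
        by rw [E.leafIso.apply_symm_apply], by rw [E.leafIso.apply_symm_apply]⟩
    · intro hc
      by_contra hn
      obtain ⟨d, s, h1, rfl⟩ := E.top.exists_leaf_above hn
      have := hr.maps (E.leafIso.symm ⟨d, h1⟩)
      rw [E.leafIso.apply_symm_apply] at this
      exact hc (Reg.desc this.reg_inv s)

theorem eq_diagram {f : F} {E : ForestDiagram} (h : E.IsReducedFor f) : E = diagram f := by
  obtain ⟨h1, h2⟩ := carets_of_isReducedFor h
  have hb : E.bot = regForest f := BinaryForest.ext_carets (h1.trans (carets_regForest f).symm)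
  have ht : E.top = regForest f⁻¹ :=
    BinaryForest.ext_carets (h2.trans (carets_regForest f⁻¹).symm)
  have hr := h.1
  clear h h1 h2
  -- The leaf bijections have types depending on the forests, so the forests are substituted first;
  -- the bijection is then forced by uniqueness of images.
  obtain ⟨B, T, bB, bT, φ⟩ := E
  dsimp only at hb ht
  subst hb ht
  unfold diagram
  congr 1
  ext a : 2
  exact Subtype.ext (Maps.unique (hr a) (isLeaf_regForest.1 a.2).maps)

theorem ell₁_diagram (f : F) :
    (diagram f).ell₁ = (Reg f⁻¹)ᶜ.ncard + (Reg f)ᶜ.ncard := by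
  rw [ForestDiagram.ell₁, BinaryForest.numCarets_eq (diagram f).top_bounded,
    BinaryForest.numCarets_eq (diagram f).bot_bounded]
  change (regForest f⁻¹).carets.ncard + (regForest f).carets.ncard = _
  rw [carets_regForest, carets_regForest]

theorem finite_compl_reg (f : F) : (Reg f)ᶜ.Finite := by
  rw [← carets_regForest]
  exact BinaryForest.finite_carets (regForest_isBounded f)

/-! ### The order of the columns -/

/-- A deep all-`false` vertex is regular, and the column above it is a prefix, hence again all
`false`. -/
theorem exists_leftmost (f : F) (i : ℤ) :
    ∃ k : ℕ, IsCol f (toLex (i, List.replicate k false)) := by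
  obtain ⟨N, hN⟩ := eventually_reg f (toLex (i, []))
  obtain ⟨d, s, hd, h⟩ := exists_isCol_above (hN (List.replicate N false) (by simp))
  have h1 : d.tree = i := (congrArg Address.tree h).symm
  have h2 : List.replicate N false = d.path ++ s := congrArg Address.path h
  have h3 : d.path = List.replicate d.path.length false := by
    rw [List.eq_replicate_iff]
    exact ⟨rfl, fun b hb => (List.eq_replicate_iff.1 h2.symm).2 b (by simp [hb])⟩
  exact ⟨d.path.length, by rwa [show toLex (i, List.replicate d.path.length false) = d from
    Address.mk_eq h1.symm h3.symm]⟩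

theorem pathStart_replicate_false (k : ℕ) : pathStart (List.replicate k false) = 0 := by
  induction k with
  | zero => rfl
  | succ k ih => simp [List.replicate_succ, pathStart, ih]

theorem append_lt_append_iff {p q r : List Bool} : p ++ q < p ++ r ↔ q < r := by
  induction p with
  | nil => simp
  | cons b p ih => simp [ih]

/-- Some column lies under each child of an irregular vertex. -/
theorem exists_isCol_under {f : F} {i : ℤ} {p : List Bool} (h : toLex (i, p) ∉ Reg f)
    (b : Bool) : ∃ s, IsCol f (toLex (i, p ++ b :: s)) := by
  by_cases h' : toLex (i, p ++ [b]) ∈ Reg f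
  · refine ⟨[], h', fun q d hq => ?_⟩
    have : q = p := by simpa using (congrArg List.dropLast hq).symm
    exact this ▸ h
  · obtain ⟨s, h1, _⟩ := BinaryForest.exists_exposed_caret (T := regForest f)
      (c := toLex (i, p ++ [b])) (by rw [carets_regForest]; exact h')
    refine ⟨s ++ [false], ?_⟩
    have h2 := isLeaf_regForest.1 h1
    rwa [show Address.left (Address.desc (toLex (i, p ++ [b])) s) =
      toLex (i, p ++ b :: (s ++ [false])) from Address.mk_eq rfl (by simp)] at h2

namespace IsCol

variable {f : F} {a b : Address} {i : ℤ} {k : ℕ}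

theorem leftmost_le (h : IsCol f (toLex (i, List.replicate k false))) (hb : IsCol f b)
    (hi : i ≤ b.tree) : toLex (i, List.replicate k false) ≤ b := by
  by_contra hc
  have h1 := hb.end_le h (not_le.1 hc)
  have h2 := (Address.start_bounds b).1
  have h3 := b.size_pos
  have h4 : Address.start (toLex (i, List.replicate k false)) = i := by
    simp [Address.start, pathStart_replicate_false]
  have h5 : (i : ℝ) ≤ b.tree := by exact_mod_cast hi
  linarith

theorem leftmost_unique (h : IsCol f (toLex (i, List.replicate k false))) (hb : IsCol f b)
    (hi : b.tree = i) (hf : ∀ d ∈ b.path, d = false) : b = toLex (i, List.replicate k false) := by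
  have e : b = toLex (i, List.replicate b.path.length false) :=
    Address.mk_eq hi (List.eq_replicate_iff.2 ⟨rfl, hf⟩)
  have hb' := hb
  rw [e] at hb'
  apply le_antisymm _ (h.leftmost_le hb hi.ge)
  rw [e]
  exact hb'.leftmost_le h le_rfl

theorem path_ne_nil (ha : IsCol f a) (hb : IsCol f b) (h : a.tree = b.tree) (hne : a ≠ b) :
    a.path ≠ [] := fun hp => hne (ha.eq_of_prefix hb h (by rw [hp]; exact List.nil_prefix))

theorem img_lt (ha : IsCol f a) (hb : IsCol f b) (h : a < b) : img f a < img f b :=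
  ha.image_lt hb h ha.maps hb.maps

theorem img_lt_iff (ha : IsCol f a) (hb : IsCol f b) : img f a < img f b ↔ a < b := by
  refine ⟨fun h => ?_, ha.img_lt hb⟩
  rcases lt_trichotomy a b with h' | rfl | h'
  · exact h'
  · exact absurd h (lt_irrefl _)
  · exact absurd (hb.img_lt ha h') h.asymm

theorem img_ne (ha : IsCol f a) (hb : IsCol f b) (h : a ≠ b) : img f a ≠ img f b := fun e =>
  h (ha.maps.injective (e ▸ hb.maps))

theorem img_isCol (ha : IsCol f a) : IsCol f⁻¹ (img f a) := ha.image ha.maps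

theorem tree_le_of_lt (h : a < b) : a.tree ≤ b.tree := by
  rcases Address.lt_iff.1 h with h | h
  · exact h.le
  · exact h.1.le

theorem tree_le_of_le (h : a ≤ b) : a.tree ≤ b.tree := by
  rcases h.eq_or_lt with rfl | h
  · exact le_rfl
  · exact tree_le_of_lt h

theorem img_path_ne_nil (ha : IsCol f a) (hb : IsCol f b) (h : (img f a).tree = (img f b).tree)
    (hne : a ≠ b) : (img f a).path ≠ [] :=
  ha.img_isCol.path_ne_nil hb.img_isCol h (ha.img_ne hb hne)

/-- If a column is a left child, some column lies under its sibling. -/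
theorem exists_sibling {p : List Bool} (ha : IsCol f a) (hp : a.path = p ++ [false]) :
    ∃ b s, IsCol f b ∧ b.tree = a.tree ∧ b.path = p ++ true :: s ∧ a < b := by
  obtain ⟨s, hs⟩ := exists_isCol_under (ha.2 p false hp) true
  refine ⟨_, s, hs, rfl, rfl, Address.lt_iff.2 (Or.inr ⟨rfl, ?_⟩)⟩
  rw [hp, Address.path_mk, append_lt_append_iff]
  simp [List.cons_lt_cons_iff]

/-- If a column is a right child, some column lies under its sibling. -/
theorem exists_sibling_left {p : List Bool} (ha : IsCol f a) (hp : a.path = p ++ [true]) :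
    ∃ b s, IsCol f b ∧ b.tree = a.tree ∧ b.path = p ++ false :: s ∧ b < a := by
  obtain ⟨s, hs⟩ := exists_isCol_under (ha.2 p true hp) false
  refine ⟨_, s, hs, rfl, rfl, Address.lt_iff.2 (Or.inr ⟨rfl, ?_⟩)⟩
  rw [hp, Address.path_mk, append_lt_append_iff]
  simp [List.cons_lt_cons_iff]

end IsCol

theorem exists_isCol_img {f : F} {b : Address} (h : IsCol f⁻¹ b) :
    ∃ a, IsCol f a ∧ img f a = b := by
  have h1 := h.maps
  have h2 := h.image h1
  rw [inv_inv] at h2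
  exact ⟨_, h2, (Maps.inv_iff.1 h1).img_eq⟩

/-- The leftmost column under the top tree of index `i`. -/
theorem exists_first (f : F) (i : ℤ) :
    ∃ a k, IsCol f a ∧ img f a = toLex (i, List.replicate k false) := by
  obtain ⟨k, hk⟩ := exists_leftmost f⁻¹ i
  obtain ⟨a, h1, h2⟩ := exists_isCol_img hk
  exact ⟨a, k, h1, h2⟩

/-- Turns the position of a column relative to the start of a top tree into a comparison of tree
indices. -/
theorem lt_first_iff {f : F} {a b : Address} {i : ℤ} {k : ℕ} (ha : IsCol f a)
    (h : img f a = toLex (i, List.replicate k false)) (hb : IsCol f b) :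
    b < a ↔ (img f b).tree < i := by
  rw [← hb.img_lt_iff ha, h]
  constructor
  · intro hl
    by_contra hc
    have := ha.img_isCol
    rw [h] at this
    exact absurd (this.leftmost_le hb.img_isCol (not_lt.1 hc)) (not_le.2 hl)
  · intro hl
    exact Address.lt_iff.2 (Or.inl hl)

theorem first_le_iff {f : F} {a b : Address} {i : ℤ} {k : ℕ} (ha : IsCol f a)
    (h : img f a = toLex (i, List.replicate k false)) (hb : IsCol f b) :
    a ≤ b ↔ i ≤ (img f b).tree := by
  rw [← not_lt, lt_first_iff ha h hb, not_lt]

theorem eq_first {f : F} {a b : Address} {i : ℤ} {k : ℕ} (ha : IsCol f a)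
    (h : img f a = toLex (i, List.replicate k false)) (hb : IsCol f b)
    (hi : (img f b).tree = i) (hf : ∀ d ∈ (img f b).path, d = false) : b = a := by
  by_contra hne
  have := ha.img_isCol
  rw [h] at this
  exact hb.img_ne ha hne ((this.leftmost_unique hb.img_isCol hi hf).trans h.symm)

/-! ### The weight function -/

/-- The column lies under or over a nontrivial tree or a pointed-to tree. -/
def Marked (f : F) (b : Address) : Prop :=
  b.tree = 0 ∨ (img f b).tree = 0 ∨ b.path ≠ [] ∨ (img f b).path ≠ []

/-- The column is marked, for a reason other than the top pointer. -/
def Key (f : F) (b : Address) : Prop := b.tree = 0 ∨ b.path ≠ [] ∨ (img f b).path ≠ []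

theorem marked_iff {f : F} {b : Address} : Marked f b ↔ Key f b ∨ (img f b).tree = 0 := by
  unfold Marked Key; tauto

open Classical in
/-- The weight of the space to the left of a column, if it lies in the support. -/
def spaceWeight (f : F) (a : Address) : ℕ :=
  if IsCol f a ∧ (∃ b, IsCol f b ∧ b < a ∧ Marked f b) ∧ ∃ b, IsCol f b ∧ a ≤ b ∧ Marked f b then
    weight (spaceLabel (img f a)) (spaceLabel a)
  else 0

theorem spaceWeight_of_not_isCol {f : F} {a : Address} (h : ¬ IsCol f a) : spaceWeight f a = 0 :=
  if_neg fun hc => h hc.1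

/-- The total weight of the spaces in the support. -/
def totalWeight (f : F) : ℕ := ∑ᶠ a, spaceWeight f a

theorem BinaryForest.IsLeaf.path_eq_nil_iff {T : BinaryForest} {c : Address} (h : T.IsLeaf c) :
    T c.tree = .nil ↔ c.path = [] := by
  constructor
  · intro h'
    unfold BinaryForest.IsLeaf at h
    rw [h'] at h
    cases hp : c.path with
    | nil => rfl
    | cons b p => rw [hp] at h; simp [subtreeAt] at h
  · intro h'
    unfold BinaryForest.IsLeaf at h
    rw [h'] at h
    simpa using h

theorem isMarked_iff {f : F} (a : (diagram f).bot.Leaf) :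
    (diagram f).IsMarked a ↔ Marked f a.1 := by
  unfold ForestDiagram.IsMarked Marked
  have h1 := (BinaryForest.IsLeaf.path_eq_nil_iff a.2).not
  have h2 := (BinaryForest.IsLeaf.path_eq_nil_iff ((diagram f).leafIso a).2).not
  rw [← ne_eq, ← ne_eq] at h1 h2
  rw [h1, h2]
  rfl

open Classical in
-- Summing over all addresses, with value zero off the support spaces, allows elements with
-- different sets of columns to be compared.
theorem ell₀_diagram (f : F) : (diagram f).ell₀ = totalWeight f := by
  have hleaf : ∀ {c}, (diagram f).bot.IsLeaf c ↔ IsCol f c := isLeaf_regForest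
  have e1 : (diagram f).ell₀ = ∑ᶠ a : (diagram f).bot.Leaf, spaceWeight f a.1 := by
    unfold ForestDiagram.ell₀
    refine finsum_congr fun a => ?_
    have : a ∈ (diagram f).supportSpaces ↔ IsCol f a.1 ∧
        (∃ b, IsCol f b ∧ b < a.1 ∧ Marked f b) ∧ ∃ b, IsCol f b ∧ a.1 ≤ b ∧ Marked f b := by
      unfold ForestDiagram.supportSpaces
      constructor
      · rintro ⟨⟨b, hb, hb'⟩, ⟨d, hd, hd'⟩⟩
        exact ⟨hleaf.1 a.2, ⟨b.1, hleaf.1 b.2, hb, (isMarked_iff b).1 hb'⟩,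
          ⟨d.1, hleaf.1 d.2, hd, (isMarked_iff d).1 hd'⟩⟩
      · rintro ⟨_, ⟨b, hb, hb1, hb'⟩, ⟨d, hd, hd1, hd'⟩⟩
        exact ⟨⟨⟨b, hleaf.2 hb⟩, hb1, (isMarked_iff ⟨b, hleaf.2 hb⟩).2 hb'⟩,
          ⟨⟨d, hleaf.2 hd⟩, hd1, (isMarked_iff ⟨d, hleaf.2 hd⟩).2 hd'⟩⟩
    rw [spaceWeight]
    by_cases h : a ∈ (diagram f).supportSpaces
    · rw [if_pos (this.1 h), finsum_eq_if, if_pos h]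
      rfl
    · rw [if_neg (fun h' => h (this.2 h')), finsum_eq_if, if_neg h]
  rw [e1, totalWeight]
  have e2 := finsum_set_coe_eq_finsum_mem (f := spaceWeight f) {c | (diagram f).bot.IsLeaf c}
  refine e2.trans (finsum_congr fun a => ?_)
  rw [finsum_eq_if]
  split_ifs with h
  · rfl
  · exact (spaceWeight_of_not_isCol fun h' => h (hleaf.2 h')).symm

theorem finite_isCol_nontrivial (f : F) : {a | IsCol f a ∧ a.path ≠ []}.Finite := by
  refine (((finite_compl_reg f).image Address.left).union
    ((finite_compl_reg f).image Address.right)).subset ?_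
  rintro a ⟨ha, hp⟩
  rcases (Address.path a).eq_nil_or_concat with h | ⟨q, b, h⟩
  · exact absurd h hp
  · rw [List.concat_eq_append] at h
    have hq := ha.2 q b h
    cases b
    · exact Or.inl ⟨_, hq, Address.mk_eq rfl h.symm⟩
    · exact Or.inr ⟨_, hq, Address.mk_eq rfl h.symm⟩

theorem finite_marked (f : F) : {a | IsCol f a ∧ Marked f a}.Finite := by
  have h1 := finite_isCol_nontrivial f
  have h2 := (((finite_isCol_nontrivial f⁻¹).insert (toLex (0, []))).image (img f⁻¹))
  refine ((h1.insert (toLex (0, []))).union h2).subset ?_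
  rintro a ⟨ha, hm⟩
  by_cases hp : Address.path a = []
  · by_cases ht : Address.tree a = 0
    · exact Or.inl (Or.inl (Address.mk_eq ht hp))
    · right
      refine ⟨img f a, ?_, ha.maps.inv.img_eq⟩
      by_cases hp' : (img f a).path = []
      · rcases hm with h | h | h | h
        · exact absurd h ht
        · exact Or.inl (Address.mk_eq h hp')
        · exact absurd hp h
        · exact absurd hp' h
      · exact Or.inr ⟨ha.img_isCol, hp'⟩
  · exact Or.inl (Or.inr ⟨ha, hp⟩)

theorem finite_support_spaceWeight (f : F) : (Function.support (spaceWeight f)).Finite := by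
  have hm := (finite_marked f).image Address.tree
  obtain ⟨lo, hlo⟩ := hm.bddBelow
  obtain ⟨hi, hhi⟩ := hm.bddAbove
  refine ((finite_isCol_nontrivial f).union
    ((Set.finite_Icc lo hi).image fun i => (toLex (i, []) : Address))).subset ?_
  intro a ha
  rw [Function.mem_support, spaceWeight] at ha
  have h := of_not_not fun hc => ha (if_neg hc)
  obtain ⟨hc, ⟨b, hb, hb1, hb2⟩, ⟨d, hd, hd1, hd2⟩⟩ := h
  by_cases hp : a.path = []
  · refine Or.inr ⟨a.tree, ⟨?_, ?_⟩, Address.mk_eq rfl hp.symm⟩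
    · exact (hlo ⟨b, ⟨hb, hb2⟩, rfl⟩).trans (IsCol.tree_le_of_lt hb1)
    · exact (IsCol.tree_le_of_le hd1).trans (hhi ⟨d, ⟨hd, hd2⟩, rfl⟩)
  · exact Or.inl ⟨hc, hp⟩

/-- Two elements whose weight functions differ at a single column. -/
theorem totalWeight_of_eq_off {f g : F} {a₁ : Address}
    (h : ∀ a, a ≠ a₁ → spaceWeight f a = spaceWeight g a) :
    totalWeight f + spaceWeight g a₁ = totalWeight g + spaceWeight f a₁ := by
  have key : ∀ f : F, totalWeight f =
      spaceWeight f a₁ + ∑ᶠ a, if a = a₁ then 0 else spaceWeight f a := by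
    intro f
    rw [← finsum_eq_single (fun a => if a = a₁ then spaceWeight f a else 0) a₁
      (fun a ha => if_neg ha) |>.trans (if_pos rfl), ← finsum_add_distrib]
    · refine finsum_congr fun a => ?_
      split_ifs <;> simp
    · exact (Set.finite_singleton a₁).subset fun a ha => by
        by_contra hc
        exact ha (if_neg hc)
    · refine (finite_support_spaceWeight f).subset fun a ha => ?_
      intro h0
      apply ha
      simp only [h0, ite_self]
  rw [key f, key g]
  have : ∀ a, (if a = a₁ then 0 else spaceWeight f a) = if a = a₁ then 0 else spaceWeight g a := by
    intro a
    split_ifs with h'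
    · rfl
    · exact h a h'
  rw [finsum_congr this]
  ring

/-! ### The action of the generators on vertices -/

theorem x₁_apply (t : ℝ) : x₁.1 t = if t ≤ 0 then t else if t ≤ 2 then t / 2 else t - 1 :=
  x₁Map_apply t

/-- The action of `x₀` on vertices. -/
def shiftAddr (b : Address) : Address := toLex (b.tree - 1, b.path)

theorem maps_x₀ (b : Address) : Maps x₀ b (shiftAddr b) := by
  intro t _
  change t - 1 = _
  have := b.size_pos
  have e : (shiftAddr b).size = b.size := rfl
  rw [e, div_self this.ne']
  simp only [shiftAddr, Address.start, Address.tree_mk, Address.path_mk, Int.cast_sub,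
    Int.cast_one]
  ring

theorem maps_x₀_inv (b : Address) : Maps x₀⁻¹ b (toLex (b.tree + 1, b.path)) := by
  rw [Maps.inv_iff]
  have := maps_x₀ (toLex (b.tree + 1, b.path))
  rwa [show shiftAddr (toLex (b.tree + 1, b.path)) = b from
    Address.mk_eq (add_sub_cancel_right _ _) rfl] at this

/-- The action of `x₁` on vertices. -/
def attachAddr (b : Address) : Address :=
  if b.tree < 0 then b else if b.tree = 0 then toLex (0, false :: b.path)
  else if b.tree = 1 then toLex (0, true :: b.path) else toLex (b.tree - 1, b.path)

theorem attachAddr_of_neg {b : Address} (h : b.tree < 0) : attachAddr b = b := if_pos h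

theorem attachAddr_of_zero {b : Address} (h : b.tree = 0) :
    attachAddr b = toLex (0, false :: b.path) := by simp [attachAddr, h]

theorem attachAddr_of_one {b : Address} (h : b.tree = 1) :
    attachAddr b = toLex (0, true :: b.path) := by simp [attachAddr, h]

theorem attachAddr_of_two_le {b : Address} (h : 2 ≤ b.tree) :
    attachAddr b = toLex (b.tree - 1, b.path) := by
  rw [attachAddr, if_neg (by omega), if_neg (by omega), if_neg (by omega)]

theorem maps_x₁ (b : Address) : Maps x₁ b (attachAddr b) := by
  have h1 := b.size_pos
  have h2 := b.start_bounds
  have hb : b.start = b.tree + pathStart b.path := rfl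
  have e0 : ∀ t : ℝ, t ≤ 0 → x₁.1 t = t := fun t ht => by rw [x₁_apply, if_pos ht]
  have e1 : ∀ t : ℝ, 0 ≤ t → t ≤ 2 → x₁.1 t = t / 2 := fun t h h' => by
    rw [x₁_apply]; split_ifs <;> linarith
  have e2 : ∀ t : ℝ, 2 ≤ t → x₁.1 t = t - 1 := fun t ht => by
    rw [x₁_apply]; split_ifs <;> linarith
  intro t ht
  have h3 := ht.1
  have h4 := ht.2
  rcases lt_or_ge b.tree 0 with c | c
  · have c' : (b.tree : ℝ) + 1 ≤ 0 := by exact_mod_cast c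
    rw [attachAddr_of_neg c, e0 t (by linarith)]
    field_simp
    ring
  obtain c | c | c : b.tree = 0 ∨ b.tree = 1 ∨ 2 ≤ b.tree := by omega
  · have hs : (attachAddr b).size = b.size / 2 := by
      rw [attachAddr_of_zero c]; simp [Address.size, pow_succ]; ring
    rw [c, Int.cast_zero] at h2 hb
    rw [e1 t (by linarith) (by linarith), hs, hb, attachAddr_of_zero c]
    simp only [Address.start, Address.tree_mk, Address.path_mk, pathStart, Int.cast_zero]
    field_simp
    ring
  · have hs : (attachAddr b).size = b.size / 2 := by
      rw [attachAddr_of_one c]; simp [Address.size, pow_succ]; ring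
    rw [c, Int.cast_one] at h2 hb
    rw [e1 t (by linarith) (by linarith), hs, hb, attachAddr_of_one c]
    simp only [Address.start, Address.tree_mk, Address.path_mk, pathStart, Int.cast_zero]
    field_simp
    ring
  · have hs : (attachAddr b).size = b.size := by
      rw [attachAddr_of_two_le c]; simp [Address.size]
    have c' : (2 : ℝ) ≤ b.tree := by exact_mod_cast c
    rw [e2 t (by linarith), hs, hb, attachAddr_of_two_le c]
    simp only [Address.start, Address.tree_mk, Address.path_mk, Int.cast_sub, Int.cast_one]
    field_simp
    ring

theorem attachAddr_injective : Function.Injective attachAddr := fun a b h =>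
  (maps_x₁ a).injective (h ▸ maps_x₁ b)

theorem attachAddr_ne_root (b : Address) : attachAddr b ≠ toLex (0, []) := by
  intro h
  have h1 := congrArg Address.tree h
  have h2 := congrArg Address.path h
  rw [Address.tree_mk] at h1
  rw [Address.path_mk] at h2
  rcases lt_or_ge b.tree 0 with c | c
  · rw [attachAddr_of_neg c] at h1; omega
  obtain c | c | c : b.tree = 0 ∨ b.tree = 1 ∨ 2 ≤ b.tree := by omega
  · rw [attachAddr_of_zero c] at h2; simp at h2
  · rw [attachAddr_of_one c] at h2; simp at h2
  · rw [attachAddr_of_two_le c, Address.tree_mk] at h1; omega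

/-- With `attachAddr_ne_root`: the only vertex missed by `attachAddr` is the root of tree 0, where
`x₁` attaches its caret. -/
theorem exists_attachAddr {c : Address} (h : c ≠ toLex (0, [])) : ∃ b, attachAddr b = c := by
  rcases lt_or_ge c.tree 0 with h1 | h1
  · exact ⟨c, attachAddr_of_neg h1⟩
  rcases h1.eq_or_lt with h2 | h2
  · cases hp : c.path with
    | nil => exact absurd (Address.mk_eq h2.symm hp) h
    | cons b p =>
      cases b
      · exact ⟨toLex (0, p), by
          rw [attachAddr_of_zero rfl]; exact Address.mk_eq h2 (by simp [hp])⟩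
      · exact ⟨toLex (1, p), by
          rw [attachAddr_of_one rfl]; exact Address.mk_eq h2 (by simp [hp])⟩
  · refine ⟨toLex (c.tree + 1, c.path), ?_⟩
    rw [attachAddr_of_two_le (by rw [Address.tree_mk]; omega)]
    exact Address.mk_eq (by simp) (by simp)

/-! ### Regular vertices and their images under left multiplication -/

theorem reg_subset_mul {s g : F} (h : ∀ b, ∃ b', Maps s b b') : Reg g ⊆ Reg (s * g) := by
  rintro a ⟨b, hb⟩
  obtain ⟨b', hb'⟩ := h b
  exact ⟨b', hb'.mul hb⟩

theorem reg_x₀_mul (g : F) : Reg (x₀ * g) = Reg g := by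
  apply Subset.antisymm
  · have := reg_subset_mul (s := x₀⁻¹) (g := x₀ * g) fun b => ⟨_, maps_x₀_inv b⟩
    rwa [inv_mul_cancel_left] at this
  · exact reg_subset_mul fun b => ⟨_, maps_x₀ b⟩

/-- The hypothesis says that no vertex is carried onto `[0, 1]`, so the new top caret is not
cancelled; every other target pulls back along `x₁`. -/
theorem reg_x₁_mul {g : F} (h : toLex (0, []) ∉ Reg (x₁ * g)⁻¹) : Reg (x₁ * g) = Reg g := by
  apply Subset.antisymm
  · rintro a ⟨b, hb⟩
    obtain ⟨b', rfl⟩ := exists_attachAddr (c := b) (by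
      rintro rfl
      exact h hb.reg_inv)
    have := (maps_x₁ b').inv.mul hb
    rw [inv_mul_cancel_left] at this
    exact this.reg
  · exact reg_subset_mul fun b => ⟨_, maps_x₁ b⟩

theorem isCol_congr {f g : F} (h : Reg f = Reg g) {a : Address} : IsCol f a ↔ IsCol g a := by
  unfold IsCol; rw [h]

theorem img_x₀_mul {g : F} {a : Address} (h : a ∈ Reg g) :
    img (x₀ * g) a = shiftAddr (img g a) := ((maps_x₀ _).mul (maps_img h)).img_eq

theorem img_x₁_mul {g : F} {a : Address} (h : a ∈ Reg g) :
    img (x₁ * g) a = attachAddr (img g a) := ((maps_x₁ _).mul (maps_img h)).img_eq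

/-! ### Labels -/

theorem spaceLabel_congr {c d : Address} (hp : c.path = d.path)
    (ht : (∀ b ∈ c.path, b = false) → (c.tree ≤ 0 ↔ d.tree ≤ 0)) :
    spaceLabel c = spaceLabel d := by
  unfold spaceLabel
  rw [← hp]
  by_cases h : ∀ b ∈ c.path, b = false
  · simp only [ht h]
  · simp only [h, false_and]

theorem spaceLabel_of_not {c d : Address} (hc : ¬ ∀ b ∈ c.path, b = false)
    (hd : ¬ ∀ b ∈ d.path, b = false) (hl : c.path.getLast? = d.path.getLast?) :
    spaceLabel c = spaceLabel d := by
  unfold spaceLabel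
  simp only [hc, hd, hl, false_and]

theorem spaceLabel_eq_L {c : Address} (h : ∀ b ∈ c.path, b = false) (ht : c.tree ≤ 0) :
    spaceLabel c = .L := if_pos ⟨h, ht⟩

/-- Attaching a caret prefixes a bit in trees 0 and 1. This keeps the last bit of a nonempty path,
and an all-`false` path in tree 0 stays all `false`; only the space at the left end of tree 1 has to
be excluded. -/
theorem spaceLabel_attachAddr {b : Address}
    (h : b.tree = 1 → ¬ ∀ d ∈ b.path, d = false) : spaceLabel (attachAddr b) = spaceLabel b := by
  rcases lt_or_ge b.tree 0 with c | c
  · rw [attachAddr_of_neg c]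
  obtain c | c | c : b.tree = 0 ∨ b.tree = 1 ∨ 2 ≤ b.tree := by omega
  · rw [attachAddr_of_zero c]
    by_cases hf : ∀ d ∈ b.path, d = false
    · rw [spaceLabel_eq_L hf c.le, spaceLabel_eq_L (by simpa using hf) le_rfl]
    · apply spaceLabel_of_not (by simpa using hf) hf
      cases hp : b.path with
      | nil => simp [hp] at hf
      | cons d p => simp
  · rw [attachAddr_of_one c]
    apply spaceLabel_of_not (by simp) (h c)
    cases hp : b.path with
    | nil => simp [hp] at h; omega
    | cons d p => simp
  · rw [attachAddr_of_two_le c]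
    refine spaceLabel_congr (c := toLex (b.tree - 1, b.path)) (d := b) rfl fun _ => ?_
    rw [Address.tree_mk]
    omega

/-! ### Changes of the weight function -/

/-- Some column at or to the right of `a` is marked for a reason other than the top pointer. -/
def KeyRight (g : F) (a : Address) : Prop := ∃ b, IsCol g b ∧ a ≤ b ∧ Key g b

/-- Some column to the left of `a` is marked for a reason other than the top pointer. -/
def KeyLeft (g : F) (a : Address) : Prop := ∃ b, IsCol g b ∧ b < a ∧ Key g b

/-- Moving the top pointer from tree 0 to tree 1 matters for the support only at the space `a₁`
between them. At any other space a column over one tree can be exchanged for one over the other,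
unless the space is inside one of these trees, which is then nontrivial and marks its columns
anyway. -/
theorem marked_left_iff {g : F} {a₁ a : Address} {k : ℕ} (ha₁ : IsCol g a₁)
    (h₁ : img g a₁ = toLex (1, List.replicate k false)) (ha : IsCol g a) (hne : a ≠ a₁) :
    (∃ b, IsCol g b ∧ b < a ∧ (Key g b ∨ (img g b).tree = 0)) ↔
      ∃ b, IsCol g b ∧ b < a ∧ (Key g b ∨ (img g b).tree = 1) := by
  constructor
  · rintro ⟨b, hb, hba, hk | ht⟩
    · exact ⟨b, hb, hba, Or.inl hk⟩
    · rcases lt_or_ge a₁ a with h | h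
      · exact ⟨a₁, ha₁, h, Or.inr (by rw [h₁]; rfl)⟩
      · have h2 := (lt_first_iff ha₁ h₁ ha).1 (lt_of_le_of_ne h hne)
        have h3 := IsCol.tree_le_of_lt (hb.img_lt ha hba)
        exact ⟨b, hb, hba, Or.inl (Or.inr (Or.inr
          (hb.img_path_ne_nil ha (by omega) hba.ne)))⟩
  · rintro ⟨b, hb, hba, hk | ht⟩
    · exact ⟨b, hb, hba, Or.inl hk⟩
    · obtain ⟨c, j, hc, hcj⟩ := exists_first g 0
      have h1 : c < b := by
        have h2 := (first_le_iff ha₁ h₁ hb).2 ht.ge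
        have h3 := (lt_first_iff ha₁ h₁ hc).2 (by rw [hcj]; exact zero_lt_one)
        exact h3.trans_le h2
      exact ⟨c, hc, h1.trans hba, Or.inr (by rw [hcj]; rfl)⟩

theorem marked_right_iff {g : F} {a₁ a : Address} {k : ℕ} (ha₁ : IsCol g a₁)
    (h₁ : img g a₁ = toLex (1, List.replicate k false)) (ha : IsCol g a) (hne : a ≠ a₁) :
    (∃ b, IsCol g b ∧ a ≤ b ∧ (Key g b ∨ (img g b).tree = 0)) ↔
      ∃ b, IsCol g b ∧ a ≤ b ∧ (Key g b ∨ (img g b).tree = 1) := by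
  constructor
  · rintro ⟨b, hb, hba, hk | ht⟩
    · exact ⟨b, hb, hba, Or.inl hk⟩
    · have h2 := (lt_first_iff ha₁ h₁ hb).2 (by omega)
      exact ⟨a₁, ha₁, hba.trans h2.le, Or.inr (by rw [h₁]; rfl)⟩
  · rintro ⟨b, hb, hba, hk | ht⟩
    · exact ⟨b, hb, hba, Or.inl hk⟩
    · rcases lt_or_ge a a₁ with h | h
      · have h2 := (lt_first_iff ha₁ h₁ ha).1 h
        rcases (show (img g a).tree ≤ 0 by omega).eq_or_lt with h3 | h3
        · exact ⟨a, ha, le_rfl, Or.inr h3⟩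
        · obtain ⟨c, j, hc, hcj⟩ := exists_first g 0
          exact ⟨c, hc, ((lt_first_iff hc hcj ha).2 h3).le, Or.inr (by rw [hcj]; rfl)⟩
      · have h2 := lt_of_le_of_ne h hne.symm
        have h3 := (first_le_iff ha₁ h₁ ha).1 h
        have h4 := IsCol.tree_le_of_le (a := img g a) (b := img g b) (by
          rcases hba.eq_or_lt with rfl | hba
          · exact le_rfl
          · exact (ha.img_lt hb hba).le)
        exact ⟨a, ha, le_rfl, Or.inl (Or.inr (Or.inr
          (ha.img_path_ne_nil ha₁ (by rw [h₁, Address.tree_mk]; omega) hne)))⟩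

open Classical in
theorem spaceWeight_congr {f g : F} {a : Address} (hc : ∀ b, IsCol f b ↔ IsCol g b)
    (hl : IsCol g a → ((∃ b, IsCol g b ∧ b < a ∧ Marked f b) ↔
      ∃ b, IsCol g b ∧ b < a ∧ Marked g b))
    (hr : IsCol g a → ((∃ b, IsCol g b ∧ a ≤ b ∧ Marked f b) ↔
      ∃ b, IsCol g b ∧ a ≤ b ∧ Marked g b))
    (hw : IsCol g a → spaceLabel (img f a) = spaceLabel (img g a)) :
    spaceWeight f a = spaceWeight g a := by
  by_cases h : IsCol g a
  · unfold spaceWeight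
    rw [hw h]
    refine if_congr ?_ rfl rfl
    simp only [hc, hl h, hr h]
  · rw [spaceWeight_of_not_isCol h, spaceWeight_of_not_isCol (fun h' => h ((hc a).1 h'))]

theorem key_x₀_mul {g : F} {b : Address} (hb : IsCol g b) : Key (x₀ * g) b ↔ Key g b := by
  unfold Key
  rw [img_x₀_mul hb.reg]
  rfl

theorem marked_x₀_mul {g : F} {b : Address} (hb : IsCol g b) :
    Marked (x₀ * g) b ↔ Key g b ∨ (img g b).tree = 1 := by
  rw [marked_iff, key_x₀_mul hb, img_x₀_mul hb.reg, shiftAddr, Address.tree_mk, sub_eq_zero]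

theorem marked_x₁_mul {g : F} {b : Address} (hb : IsCol g b) :
    Marked (x₁ * g) b ↔ Key g b ∨ (img g b).tree = 0 ∨ (img g b).tree = 1 := by
  unfold Marked Key
  rw [img_x₁_mul hb.reg]
  rcases lt_or_ge (img g b).tree 0 with c | c
  · rw [attachAddr_of_neg c]
    have : (img g b).tree ≠ 1 := by omega
    tauto
  obtain c | c | c : (img g b).tree = 0 ∨ (img g b).tree = 1 ∨ 2 ≤ (img g b).tree := by omega
  · rw [attachAddr_of_zero c]; simp [c]
  · rw [attachAddr_of_one c]; simp [c]
  · rw [attachAddr_of_two_le c, Address.tree_mk, Address.path_mk]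
    have h1 : (img g b).tree ≠ 0 := by omega
    have h2 : (img g b).tree ≠ 1 := by omega
    have h3 : (img g b).tree - 1 ≠ 0 := by omega
    tauto

theorem exists_and_or {α : Type*} {p q r s : α → Prop} :
    (∃ b, p b ∧ q b ∧ (r b ∨ s b)) ↔ (∃ b, p b ∧ q b ∧ r b) ∨ ∃ b, p b ∧ q b ∧ s b := by
  simp only [and_or_left, exists_or]

theorem or_absorb {p q r : Prop} (h : p ∨ q ↔ p ∨ r) : p ∨ q ∨ r ↔ p ∨ q := by tauto

theorem spaceWeight_x₀_mul_of_ne {g : F} {a₁ a : Address} {k : ℕ} (ha₁ : IsCol g a₁)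
    (h₁ : img g a₁ = toLex (1, List.replicate k false)) (hne : a ≠ a₁) :
    spaceWeight (x₀ * g) a = spaceWeight g a := by
  refine spaceWeight_congr (fun b => isCol_congr (reg_x₀_mul g)) (fun ha => ?_) (fun ha => ?_)
    (fun ha => ?_)
  · have := marked_left_iff ha₁ h₁ ha hne
    simp only [marked_iff (f := g), this]
    exact exists_congr fun b => and_congr_right fun hb => by rw [marked_x₀_mul hb]
  · have := marked_right_iff ha₁ h₁ ha hne
    simp only [marked_iff (f := g), this]
    exact exists_congr fun b => and_congr_right fun hb => by rw [marked_x₀_mul hb]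
  · rw [img_x₀_mul ha.reg]
    refine spaceLabel_congr (c := shiftAddr (img g a)) (d := img g a) rfl fun hf => ?_
    have : (img g a).tree ≠ 1 := fun ht => hne (eq_first ha₁ h₁ ha ht hf)
    rw [shiftAddr, Address.tree_mk]
    omega

theorem spaceWeight_x₁_mul_of_ne {g : F} {a₁ a : Address} {k : ℕ}
    (hroot : toLex (0, []) ∉ Reg (x₁ * g)⁻¹) (ha₁ : IsCol g a₁)
    (h₁ : img g a₁ = toLex (1, List.replicate k false)) (hne : a ≠ a₁) :
    spaceWeight (x₁ * g) a = spaceWeight g a := by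
  refine spaceWeight_congr (fun b => isCol_congr (reg_x₁_mul hroot)) (fun ha => ?_) (fun ha => ?_)
    (fun ha => ?_)
  · have h := marked_left_iff ha₁ h₁ ha hne
    have : (∃ b, IsCol g b ∧ b < a ∧ Marked (x₁ * g) b) ↔
        ∃ b, IsCol g b ∧ b < a ∧ (Key g b ∨ (img g b).tree = 0 ∨ (img g b).tree = 1) :=
      exists_congr fun b => and_congr_right fun hb => by rw [marked_x₁_mul hb]
    rw [this]
    simp only [marked_iff (f := g)]
    simp only [exists_and_or] at h ⊢
    exact or_absorb h
  · have h := marked_right_iff ha₁ h₁ ha hne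
    have : (∃ b, IsCol g b ∧ a ≤ b ∧ Marked (x₁ * g) b) ↔
        ∃ b, IsCol g b ∧ a ≤ b ∧ (Key g b ∨ (img g b).tree = 0 ∨ (img g b).tree = 1) :=
      exists_congr fun b => and_congr_right fun hb => by rw [marked_x₁_mul hb]
    rw [this]
    simp only [marked_iff (f := g)]
    simp only [exists_and_or] at h ⊢
    exact or_absorb h
  · rw [img_x₁_mul ha.reg]
    exact spaceLabel_attachAddr fun ht hf => hne (eq_first ha₁ h₁ ha ht hf)

theorem spaceLabel_first {i : ℤ} (hi : 0 < i) (k : ℕ) :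
    spaceLabel (toLex (i, List.replicate k false)) = if k = 0 then .R else .N := by
  unfold spaceLabel
  rw [Address.tree_mk, Address.path_mk, if_neg (by omega)]
  cases k with
  | zero => simp
  | succ k => simp [List.replicate_succ']

theorem spaceLabel_attach_first (k : ℕ) :
    spaceLabel (toLex (0, true :: List.replicate k false)) = if k = 0 then .I else .N := by
  unfold spaceLabel
  rw [Address.tree_mk, Address.path_mk, if_neg (by simp)]
  cases k with
  | zero => simp
  | succ k => simp [List.replicate_succ', List.getLast?_cons]

theorem exists_lt_first_tree_zero {g : F} {a₁ : Address} {k : ℕ} (ha₁ : IsCol g a₁)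
    (h₁ : img g a₁ = toLex (1, List.replicate k false)) :
    ∃ b, IsCol g b ∧ b < a₁ ∧ (img g b).tree = 0 := by
  obtain ⟨c, j, hc, hcj⟩ := exists_first g 0
  exact ⟨c, hc, (lt_first_iff ha₁ h₁ hc).2 (by rw [hcj]; exact zero_lt_one), by rw [hcj]; rfl⟩

open Classical in
-- The top pointer always marks a column to the left, so only the right side decides membership in
-- the support; columns there are not under top tree 0, so their marks have another reason.
theorem spaceWeight_first {g : F} {a₁ : Address} {k : ℕ} (ha₁ : IsCol g a₁)
    (h₁ : img g a₁ = toLex (1, List.replicate k false)) :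
    spaceWeight g a₁ = if KeyRight g a₁ then
      weight (if k = 0 then .R else .N) (spaceLabel a₁) else 0 := by
  unfold spaceWeight
  rw [h₁, spaceLabel_first zero_lt_one]
  refine if_congr ⟨?_, ?_⟩ rfl rfl
  · rintro ⟨_, _, b, hb, hb1, hb2⟩
    rcases marked_iff.1 hb2 with h | h
    · exact ⟨b, hb, hb1, h⟩
    · have := (first_le_iff ha₁ h₁ hb).1 hb1
      omega
  · rintro ⟨b, hb, hb1, hb2⟩
    obtain ⟨c, hc, hc1, hc2⟩ := exists_lt_first_tree_zero ha₁ h₁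
    exact ⟨ha₁, ⟨c, hc, hc1, marked_iff.2 (Or.inr hc2)⟩, b, hb, hb1, marked_iff.2 (Or.inl hb2)⟩

open Classical in
-- The pointer has moved to the tree starting at `a₁`, which marks the right side; now only the left
-- side decides.
theorem spaceWeight_x₀_mul_first {g : F} {a₁ : Address} {k : ℕ} (ha₁ : IsCol g a₁)
    (h₁ : img g a₁ = toLex (1, List.replicate k false)) :
    spaceWeight (x₀ * g) a₁ = if KeyLeft g a₁ then weight .L (spaceLabel a₁) else 0 := by
  have hc : ∀ b, IsCol (x₀ * g) b ↔ IsCol g b := fun b => isCol_congr (reg_x₀_mul g)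
  unfold spaceWeight
  rw [img_x₀_mul ha₁.reg, h₁, spaceLabel_eq_L (c := shiftAddr _)
    (by simp [shiftAddr, List.mem_replicate]) (by simp [shiftAddr])]
  refine if_congr ⟨?_, ?_⟩ rfl rfl
  · rintro ⟨_, ⟨b, hb, hb1, hb2⟩, _⟩
    rw [hc] at hb
    rcases (marked_x₀_mul hb).1 hb2 with h | h
    · exact ⟨b, hb, hb1, h⟩
    · have := (lt_first_iff ha₁ h₁ hb).1 hb1
      omega
  · rintro ⟨b, hb, hb1, hb2⟩
    exact ⟨(hc _).2 ha₁, ⟨b, (hc _).2 hb, hb1, (marked_x₀_mul hb).2 (Or.inl hb2)⟩, a₁,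
      (hc _).2 ha₁, le_rfl, (marked_x₀_mul ha₁).2 (Or.inr (by rw [h₁]; rfl))⟩

theorem spaceWeight_x₁_mul_first {g : F} {a₁ : Address} {k : ℕ}
    (hroot : toLex (0, []) ∉ Reg (x₁ * g)⁻¹) (ha₁ : IsCol g a₁)
    (h₁ : img g a₁ = toLex (1, List.replicate k false)) :
    spaceWeight (x₁ * g) a₁ = weight (if k = 0 then .I else .N) (spaceLabel a₁) := by
  have hc : ∀ b, IsCol (x₁ * g) b ↔ IsCol g b := fun b => isCol_congr (reg_x₁_mul hroot)
  unfold spaceWeight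
  rw [img_x₁_mul ha₁.reg, h₁, attachAddr_of_one (by rfl), Address.path_mk,
    spaceLabel_attach_first]
  obtain ⟨c, hc', hc1, hc2⟩ := exists_lt_first_tree_zero ha₁ h₁
  exact if_pos ⟨(hc _).2 ha₁, ⟨c, (hc _).2 hc', hc1, (marked_x₁_mul hc').2 (Or.inr (Or.inl hc2))⟩,
    a₁, (hc _).2 ha₁, le_rfl, (marked_x₁_mul ha₁).2 (Or.inr (Or.inr (by rw [h₁]; rfl)))⟩

/-! ### Bottom labels at the ends of the support -/

theorem exists_bottom_pointer (g : F) : ∃ k, IsCol g (toLex (0, List.replicate k false)) ∧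
    Key g (toLex (0, List.replicate k false)) := by
  obtain ⟨k, hk⟩ := exists_leftmost g 0
  exact ⟨k, hk, Or.inl rfl⟩

/-- The tree at the bottom pointer always contains a keyed column, so `a` lies beyond that tree,
over a trivial bottom tree. The bottom label is thus `R`. -/
theorem of_not_keyRight {g : F} {a : Address} (ha : IsCol g a) (h : ¬ KeyRight g a) :
    0 < a.tree ∧ a.path = [] := by
  obtain ⟨k, h1, h2⟩ := exists_bottom_pointer g
  have h3 : ¬ Key g a := fun hk => h ⟨a, ha, le_rfl, hk⟩
  have h4 : toLex (0, List.replicate k false) < a := by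
    by_contra hc
    exact h ⟨_, h1, not_lt.1 hc, h2⟩
  unfold Key at h3
  push Not at h3
  exact ⟨lt_of_le_of_ne (IsCol.tree_le_of_lt h4) (Ne.symm h3.1), h3.2.1⟩

theorem spaceLabel_root_of_pos {a : Address} (h : 0 < a.tree) (hp : a.path = []) :
    spaceLabel a = .R := by
  unfold spaceLabel
  rw [if_neg (by omega), hp]
  simp

/-- The bottom label is `L`: the space is not beyond the start of bottom tree 0, and inside a
nontrivial tree the leftmost leaf would be keyed. -/
theorem of_not_keyLeft {g : F} {a : Address} (ha : IsCol g a) (h : ¬ KeyLeft g a) :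
    a.tree ≤ 0 ∧ ∀ d ∈ a.path, d = false := by
  obtain ⟨k, h1, h2⟩ := exists_bottom_pointer g
  have h4 : a ≤ toLex (0, List.replicate k false) := by
    by_contra hc
    exact h ⟨_, h1, not_le.1 hc, h2⟩
  refine ⟨IsCol.tree_le_of_le h4, ?_⟩
  obtain ⟨j, hj⟩ := exists_leftmost g a.tree
  have h5 : toLex (a.tree, List.replicate j false) = a := by
    by_contra hne
    have h6 := lt_of_le_of_ne (hj.leftmost_le ha le_rfl) hne
    exact h ⟨_, hj, h6, Or.inr (Or.inl (hj.path_ne_nil ha rfl hne))⟩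
  rw [← h5]
  simp [List.mem_replicate]

theorem keyLeft_or_keyRight {g : F} (a : Address) : KeyLeft g a ∨ KeyRight g a := by
  obtain ⟨k, h1, h2⟩ := exists_bottom_pointer g
  rcases lt_or_ge (toLex (0, List.replicate k false)) a with h | h
  · exact Or.inl ⟨_, h1, h, h2⟩
  · exact Or.inr ⟨_, h1, h, h2⟩

/-! ### Cancellation of a bottom caret -/

theorem Address.lt_left (c : Address) : c < c.left := by
  refine Address.lt_iff.2 (Or.inr ⟨rfl, ?_⟩)
  have := append_lt_append_iff (p := c.path) (q := []) (r := [false])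
  simpa using this

theorem Address.left_lt_right (c : Address) : c.left < c.right :=
  Address.lt_iff.2 (Or.inr ⟨rfl, append_lt_append_iff.2 (by simp [List.cons_lt_cons_iff])⟩)

theorem weight_L_spaceLabel (c : Address) :
    weight .L (spaceLabel c) = if (∀ b ∈ c.path, b = false) ∧ c.tree ≤ 0 then 2 else 1 := by
  unfold spaceLabel
  split_ifs <;> rfl

section Cancel

variable {g : F} {c : Address}

theorem maps_left_of_cancel (hc : Maps (x₁ * g) c (toLex (0, []))) :
    Maps g c.left (toLex (0, [])) := by
  have h := (maps_x₁ (toLex (0, []))).inv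
  rw [attachAddr_of_zero rfl] at h
  have := h.mul (hc.left)
  rwa [inv_mul_cancel_left] at this

theorem maps_right_of_cancel (hc : Maps (x₁ * g) c (toLex (0, []))) :
    Maps g c.right (toLex (1, [])) := by
  have h := (maps_x₁ (toLex (1, []))).inv
  rw [attachAddr_of_one rfl] at h
  have := h.mul (hc.right)
  rwa [inv_mul_cancel_left] at this

theorem not_reg_of_cancel (hc : Maps (x₁ * g) c (toLex (0, []))) : c ∉ Reg g := by
  rintro ⟨b, hb⟩
  exact attachAddr_ne_root b (((maps_x₁ b).mul hb).unique hc)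

theorem isCol_left_of_cancel (hc : Maps (x₁ * g) c (toLex (0, []))) : IsCol g c.left := by
  refine ⟨(maps_left_of_cancel hc).reg, fun q b hq => ?_⟩
  obtain ⟨rfl, -⟩ := List.append_inj' hq.symm rfl
  exact not_reg_of_cancel hc

theorem isCol_right_of_cancel (hc : Maps (x₁ * g) c (toLex (0, []))) : IsCol g c.right := by
  refine ⟨(maps_right_of_cancel hc).reg, fun q b hq => ?_⟩
  obtain ⟨rfl, -⟩ := List.append_inj' hq.symm rfl
  exact not_reg_of_cancel hc

/-- Only `c` is sent onto the root of tree 0, and that root is the only vertex that does not pull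
back along `x₁`. -/
theorem reg_of_cancel (hc : Maps (x₁ * g) c (toLex (0, []))) :
    Reg (x₁ * g) = insert c (Reg g) := by
  apply Subset.antisymm
  · rintro a ⟨b, hb⟩
    by_cases h : b = toLex (0, [])
    · subst h
      exact Or.inl (hb.injective hc)
    · obtain ⟨b', rfl⟩ := exists_attachAddr h
      have := (maps_x₁ b').inv.mul hb
      rw [inv_mul_cancel_left] at this
      exact Or.inr this.reg
  · exact insert_subset hc.reg (reg_subset_mul fun b => ⟨_, maps_x₁ b⟩)

theorem isCol_of_cancel (hc : Maps (x₁ * g) c (toLex (0, []))) {a : Address} :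
    IsCol (x₁ * g) a ↔ a = c ∨ (IsCol g a ∧ a ≠ c.left ∧ a ≠ c.right) := by
  have hreg := reg_of_cancel hc
  have hsub : Reg g ⊆ Reg (x₁ * g) := hreg ▸ subset_insert _ _
  constructor
  · intro h
    by_cases ha : a = c
    · exact Or.inl ha
    · right
      have h1 := h.1
      rw [hreg] at h1
      refine ⟨⟨h1.resolve_left ha, fun q b hq hr => h.2 q b hq (hsub hr)⟩, ?_, ?_⟩
      · rintro rfl
        exact h.2 c.path false rfl hc.reg
      · rintro rfl
        exact h.2 c.path true rfl hc.reg
  · rintro (rfl | ⟨h, h1, h2⟩)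
    · refine ⟨hc.reg, fun q b hq hr => ?_⟩
      rw [hreg] at hr
      rcases hr with hr | hr
      · have := congrArg Address.path hr
        rw [hq] at this
        simp at this
      · have := Reg.desc hr [b]
        rw [show Address.desc (toLex (a.tree, q)) [b] = a from Address.mk_eq rfl hq.symm] at this
        exact not_reg_of_cancel hc this
    · refine ⟨hsub h.1, fun q b hq hr => ?_⟩
      rw [hreg] at hr
      rcases hr with hr | hr
      · have e : a = c.desc [b] := by
          rw [← hr]
          exact Address.mk_eq rfl hq
        cases b
        · exact h1 e
        · exact h2 e
      · exact h.2 q b hq hr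

theorem right_lt_of_cancel (hc : Maps (x₁ * g) c (toLex (0, []))) {a : Address} (ha : IsCol g a)
    (h1 : a ≠ c.left) (h2 : a ≠ c.right) (h : c < a) : c.right < a := by
  rcases Address.of_lt h with ⟨h3, h4⟩ | h3
  · obtain ⟨q, rfl⟩ := Address.eq_desc h3 h4
    exfalso
    match q with
    | [] => exact not_reg_of_cancel hc (by simpa only [Address.desc_nil] using ha.reg)
    | false :: q =>
      rw [Address.desc_false_cons] at ha h1
      rw [ha.eq_of_desc (maps_left_of_cancel hc).reg] at h1
      exact h1 (Address.desc_nil _)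
    | true :: q =>
      rw [Address.desc_true_cons] at ha h2
      rw [ha.eq_of_desc (maps_right_of_cancel hc).reg] at h2
      exact h2 (Address.desc_nil _)
  · apply Address.lt_of_start_lt
    rw [Address.start_right]
    linarith [c.size_pos]

/-- The top trees 0 and 1 of `g` are trivial, so each has a single column. -/
theorem img_tree_of_cancel (hc : Maps (x₁ * g) c (toLex (0, []))) {a : Address} (ha : IsCol g a)
    (h1 : a ≠ c.left) (h2 : a ≠ c.right) : (img g a).tree ≠ 0 ∧ (img g a).tree ≠ 1 := by
  refine ⟨fun h => ?_, fun h => ?_⟩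
  · have := (isCol_left_of_cancel hc).img_path_ne_nil ha
      (by rw [(maps_left_of_cancel hc).img_eq, h]; rfl) h1.symm
    rw [(maps_left_of_cancel hc).img_eq] at this
    exact this rfl
  · have := (isCol_right_of_cancel hc).img_path_ne_nil ha
      (by rw [(maps_right_of_cancel hc).img_eq, h]; rfl) h2.symm
    rw [(maps_right_of_cancel hc).img_eq] at this
    exact this rfl

theorem marked_of_cancel (hc : Maps (x₁ * g) c (toLex (0, []))) {a : Address} (ha : IsCol g a)
    (h1 : a ≠ c.left) (h2 : a ≠ c.right) : Marked (x₁ * g) a ↔ Marked g a := by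
  obtain ⟨h3, h4⟩ := img_tree_of_cancel hc ha h1 h2
  rw [marked_x₁_mul ha, marked_iff]
  tauto

theorem marked_left_of_cancel (hc : Maps (x₁ * g) c (toLex (0, []))) : Marked g c.left :=
  Or.inr (Or.inl (by rw [(maps_left_of_cancel hc).img_eq]; rfl))

theorem marked_cancel (hc : Maps (x₁ * g) c (toLex (0, []))) : Marked (x₁ * g) c :=
  Or.inr (Or.inl (by rw [hc.img_eq]; rfl))

open Classical in
-- Both top labels are `L`, against which a bottom label matters only through being `L` or not;
-- appending `false` to the path does not affect that.
theorem spaceWeight_cancel (hc : Maps (x₁ * g) c (toLex (0, []))) :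
    spaceWeight (x₁ * g) c = spaceWeight g c.left := by
  have hcl := isCol_left_of_cancel hc
  have hcol : IsCol (x₁ * g) c := (isCol_of_cancel hc).2 (Or.inl rfl)
  have hlt := c.lt_left
  have hlr := c.left_lt_right
  unfold spaceWeight
  rw [hc.img_eq, (maps_left_of_cancel hc).img_eq, spaceLabel_eq_L (by simp) (by simp),
    weight_L_spaceLabel, weight_L_spaceLabel]
  have e : ((∀ b ∈ c.left.path, b = false) ∧ c.left.tree ≤ 0) ↔
      ((∀ b ∈ c.path, b = false) ∧ c.tree ≤ 0) := by
    simp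
  simp only [e]
  refine if_congr ⟨?_, ?_⟩ rfl rfl
  · rintro ⟨_, ⟨b, hb, hb1, hb2⟩, _⟩
    refine ⟨hcl, ?_, _, hcl, le_rfl, marked_left_of_cancel hc⟩
    rcases (isCol_of_cancel hc).1 hb with rfl | ⟨h1, h2, h3⟩
    · exact absurd hb1 (lt_irrefl _)
    · exact ⟨b, h1, hb1.trans hlt, (marked_of_cancel hc h1 h2 h3).1 hb2⟩
  · rintro ⟨_, ⟨b, hb, hb1, hb2⟩, _⟩
    refine ⟨hcol, ?_, _, hcol, le_rfl, marked_cancel hc⟩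
    have h2 : b ≠ c.left := hb1.ne
    have h3 : b ≠ c.right := (hb1.trans hlr).ne
    refine ⟨b, (isCol_of_cancel hc).2 (Or.inr ⟨hb, h2, h3⟩), ?_,
      (marked_of_cancel hc hb h2 h3).2 hb2⟩
    rcases lt_trichotomy b c with h | rfl | h
    · exact h
    · exact absurd hb.reg (not_reg_of_cancel hc)
    · exact absurd (right_lt_of_cancel hc hb h2 h3 h) (hb1.trans hlr).asymm

/-- This is the space inside the cancelled caret, with label `R` above and `I` below. -/
theorem spaceWeight_right_of_cancel (hc : Maps (x₁ * g) c (toLex (0, []))) :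
    spaceWeight g c.right = 0 := by
  unfold spaceWeight
  rw [(maps_right_of_cancel hc).img_eq, spaceLabel_root_of_pos (a := toLex (1, [])) (by simp) rfl]
  have : spaceLabel c.right = .I := by
    unfold spaceLabel
    simp
  rw [this]
  simp [weight]

open Classical in
theorem spaceWeight_of_cancel (hc : Maps (x₁ * g) c (toLex (0, []))) {a : Address} (h0 : a ≠ c)
    (h1 : a ≠ c.left) (h2 : a ≠ c.right) : spaceWeight (x₁ * g) a = spaceWeight g a := by
  have hlt := c.lt_left
  have hlr := c.left_lt_right
  have hcl := isCol_left_of_cancel hc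
  have hcol : IsCol (x₁ * g) c := (isCol_of_cancel hc).2 (Or.inl rfl)
  have hiff : IsCol (x₁ * g) a ↔ IsCol g a := by
    rw [isCol_of_cancel hc]
    tauto
  by_cases ha : IsCol g a
  swap
  · rw [spaceWeight_of_not_isCol ha, spaceWeight_of_not_isCol (fun h => ha (hiff.1 h))]
  have hout : ∀ b, IsCol g b → b ≠ c.left → b ≠ c.right → IsCol (x₁ * g) b := fun b hb h h' =>
    (isCol_of_cancel hc).2 (Or.inr ⟨hb, h, h'⟩)
  have hac : a < c.right → a < c := by
    intro h
    rcases lt_trichotomy a c with h' | h' | h'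
    · exact h'
    · exact absurd h' h0
    · exact absurd (right_lt_of_cancel hc ha h1 h2 h') h.asymm
  have hlab : spaceLabel (img (x₁ * g) a) = spaceLabel (img g a) := by
    rw [img_x₁_mul ha.reg]
    exact spaceLabel_attachAddr fun h => absurd h (img_tree_of_cancel hc ha h1 h2).2
  unfold spaceWeight
  rw [hlab]
  refine if_congr (and_congr hiff (and_congr ⟨?_, ?_⟩ ⟨?_, ?_⟩)) rfl rfl
  · rintro ⟨b, hb, hb1, hb2⟩
    rcases (isCol_of_cancel hc).1 hb with rfl | ⟨h3, h4, h5⟩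
    · exact ⟨_, hcl, hlr.trans (right_lt_of_cancel hc ha h1 h2 hb1), marked_left_of_cancel hc⟩
    · exact ⟨b, h3, hb1, (marked_of_cancel hc h3 h4 h5).1 hb2⟩
  · rintro ⟨b, hb, hb1, hb2⟩
    by_cases h4 : b = c.left
    · subst h4
      exact ⟨c, hcol, hlt.trans hb1, marked_cancel hc⟩
    · by_cases h5 : b = c.right
      · subst h5
        exact ⟨c, hcol, (hlt.trans hlr).trans hb1, marked_cancel hc⟩
      · exact ⟨b, hout b hb h4 h5, hb1, (marked_of_cancel hc hb h4 h5).2 hb2⟩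
  · rintro ⟨b, hb, hb1, hb2⟩
    rcases (isCol_of_cancel hc).1 hb with rfl | ⟨h3, h4, h5⟩
    · exact ⟨_, hcl, hb1.trans hlt.le, marked_left_of_cancel hc⟩
    · exact ⟨b, h3, hb1, (marked_of_cancel hc h3 h4 h5).1 hb2⟩
  · rintro ⟨b, hb, hb1, hb2⟩
    by_cases h4 : b = c.left
    · subst h4
      exact ⟨c, hcol, (hac (hb1.trans_lt hlr)).le, marked_cancel hc⟩
    · by_cases h5 : b = c.right
      · subst h5
        exact ⟨c, hcol, (hac (lt_of_le_of_ne hb1 h2)).le, marked_cancel hc⟩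
      · exact ⟨b, hout b hb h4 h5, hb1, (marked_of_cancel hc hb h4 h5).2 hb2⟩

theorem totalWeight_cancel (hc : Maps (x₁ * g) c (toLex (0, []))) :
    totalWeight (x₁ * g) = totalWeight g := by
  have hlt := c.lt_left
  have hlr := c.left_lt_right
  unfold totalWeight
  -- After cancellation `c` takes over the space of `c.left`, hence the swap. Each of the two is a
  -- column for only one of the elements, and `c.right` contributes zero.
  rw [← finsum_comp_equiv (Equiv.swap c c.left) (f := spaceWeight g)]
  refine finsum_congr fun a => ?_
  by_cases h0 : a = c
  · subst h0
    rw [Equiv.swap_apply_left, spaceWeight_cancel hc]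
  by_cases h1 : a = c.left
  · subst h1
    rw [Equiv.swap_apply_right, spaceWeight_of_not_isCol (f := g)
      (fun h => not_reg_of_cancel hc h.reg), spaceWeight_of_not_isCol]
    rw [isCol_of_cancel hc]
    simp [hlt.ne']
  rw [Equiv.swap_apply_of_ne_of_ne h0 h1]
  by_cases h2 : a = c.right
  · subst h2
    rw [spaceWeight_right_of_cancel hc, spaceWeight_of_not_isCol]
    rw [isCol_of_cancel hc]
    simp [h0]
  · exact spaceWeight_of_cancel hc h0 h1 h2

end Cancel

/-! ### Counting carets -/

/-- The number of carets of the reduced diagram. -/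
def caretCount (f : F) : ℕ := (Reg f⁻¹)ᶜ.ncard + (Reg f)ᶜ.ncard

theorem image_compl_reg {s g : F} {σ : Address → Address} (hs : ∀ b, Maps s b (σ b)) :
    σ '' (Reg g⁻¹)ᶜ = (Reg (s * g)⁻¹)ᶜ ∩ range σ := by
  ext b
  constructor
  · rintro ⟨a, ha, rfl⟩
    exact ⟨fun h => ha ((reg_mul_iff (hs a)).1 h), a, rfl⟩
  · rintro ⟨hb, a, rfl⟩
    exact ⟨a, fun h => hb ((reg_mul_iff (hs a)).2 h), rfl⟩

theorem maps_injective {s : F} {σ : Address → Address} (hs : ∀ b, Maps s b (σ b)) :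
    Function.Injective σ := fun a b h => (hs a).injective (h ▸ hs b)

theorem compl_reg_inv_x₀_mul (g : F) : (Reg (x₀ * g)⁻¹)ᶜ = shiftAddr '' (Reg g⁻¹)ᶜ := by
  rw [image_compl_reg maps_x₀, inter_eq_left.2]
  exact fun b _ => ⟨toLex (b.tree + 1, b.path), Address.mk_eq (add_sub_cancel_right _ _) rfl⟩

theorem caretCount_x₀_mul (g : F) : caretCount (x₀ * g) = caretCount g := by
  rw [caretCount, caretCount, reg_x₀_mul, compl_reg_inv_x₀_mul,
    ncard_image_of_injective _ (maps_injective maps_x₀)]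

theorem compl_reg_inv_x₁_mul_cancel {g : F} (h : toLex (0, []) ∈ Reg (x₁ * g)⁻¹) :
    (Reg (x₁ * g)⁻¹)ᶜ = attachAddr '' (Reg g⁻¹)ᶜ := by
  rw [image_compl_reg maps_x₁, inter_eq_left.2]
  intro b hb
  exact exists_attachAddr (fun hb' => hb (hb' ▸ h))

theorem compl_reg_inv_x₁_mul {g : F} (h : toLex (0, []) ∉ Reg (x₁ * g)⁻¹) :
    (Reg (x₁ * g)⁻¹)ᶜ = insert (toLex (0, [])) (attachAddr '' (Reg g⁻¹)ᶜ) := by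
  rw [image_compl_reg maps_x₁]
  ext b
  constructor
  · intro hb
    by_cases h0 : b = toLex (0, [])
    · exact Or.inl h0
    · exact Or.inr ⟨hb, exists_attachAddr h0⟩
  · rintro (rfl | hb)
    · exact h
    · exact hb.1

theorem caretCount_x₁_mul {g : F} (h : toLex (0, []) ∉ Reg (x₁ * g)⁻¹) :
    caretCount (x₁ * g) = caretCount g + 1 := by
  rw [caretCount, caretCount, reg_x₁_mul h, compl_reg_inv_x₁_mul h,
    ncard_insert_of_notMem ?_ ((finite_compl_reg _).image _),
    ncard_image_of_injective _ attachAddr_injective]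
  · ring
  · rintro ⟨b, _, hb⟩
    exact attachAddr_ne_root b hb

theorem compl_reg_cancel {g : F} {c : Address} (hc : Maps (x₁ * g) c (toLex (0, []))) :
    (Reg g)ᶜ = insert c (Reg (x₁ * g))ᶜ := by
  rw [reg_of_cancel hc]
  ext a
  simp only [mem_compl_iff, mem_insert_iff]
  have := not_reg_of_cancel hc
  by_cases h : a = c
  · subst h; simpa
  · simp [h]

theorem caretCount_cancel {g : F} {c : Address} (hc : Maps (x₁ * g) c (toLex (0, []))) :
    caretCount g = caretCount (x₁ * g) + 1 := by
  rw [caretCount, caretCount, compl_reg_cancel hc, ncard_insert_of_notMem (notMem_compl_iff.2 hc.reg)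
    (finite_compl_reg _), compl_reg_inv_x₁_mul_cancel hc.reg_inv,
    ncard_image_of_injective _ attachAddr_injective]
  ring

/-! ### The length function changes by at most one -/

/-- The length `ℓ₀ + ℓ₁`. -/
def len (f : F) : ℕ := totalWeight f + caretCount f

/-- The top label of one space passes from `R` or `N` to `L`, which changes its weight by exactly
one against every bottom label. If the space enters the support its bottom label is `R`, if it
leaves the support its bottom label is `L`; the weight is then 0 on one side and 1 on the other. -/
theorem len_x₀_mul (g : F) : len (x₀ * g) ≤ len g + 1 ∧ len g ≤ len (x₀ * g) + 1 := by
  obtain ⟨a, k, ha, h⟩ := exists_first g 1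
  have h1 := totalWeight_of_eq_off (fun b hb => spaceWeight_x₀_mul_of_ne (a := b) ha h hb)
  have h2 : spaceWeight (x₀ * g) a ≤ spaceWeight g a + 1 ∧
      spaceWeight g a ≤ spaceWeight (x₀ * g) a + 1 := by
    rw [spaceWeight_first ha h, spaceWeight_x₀_mul_first ha h]
    by_cases hl : KeyLeft g a
    · rw [if_pos hl]
      by_cases hr : KeyRight g a
      · rw [if_pos hr]
        generalize spaceLabel a = s
        by_cases hk : k = 0 <;> simp only [hk, if_true, if_false] <;> cases s <;> decide
      · rw [if_neg hr, spaceLabel_root_of_pos (of_not_keyRight ha hr).1 (of_not_keyRight ha hr).2]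
        decide
    · rw [if_neg hl, if_pos ((keyLeft_or_keyRight a).resolve_left hl),
        spaceLabel_eq_L (of_not_keyLeft ha hl).2 (of_not_keyLeft ha hl).1]
      by_cases hk : k = 0 <;> simp only [hk, if_true, if_false] <;> decide
  unfold len
  rw [caretCount_x₀_mul]
  omega

/-- Cancellation removes one caret and keeps the total weight. Creation adds a caret and turns a top
label `R` into `I`, or keeps `N`, at one space: the weight drops by two at `{R, R}` inside the
support and is otherwise unchanged. -/
theorem len_x₁_mul (g : F) : len (x₁ * g) ≤ len g + 1 ∧ len g ≤ len (x₁ * g) + 1 := by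
  unfold len
  by_cases hroot : toLex (0, []) ∈ Reg (x₁ * g)⁻¹
  · obtain ⟨c, hc⟩ := hroot
    have hc := Maps.inv_iff.1 hc
    rw [totalWeight_cancel hc, caretCount_cancel hc]
    omega
  obtain ⟨a, k, ha, h⟩ := exists_first g 1
  have h1 := totalWeight_of_eq_off (fun b hb => spaceWeight_x₁_mul_of_ne (a := b) hroot ha h hb)
  rw [caretCount_x₁_mul hroot]
  have h2 : spaceWeight (x₁ * g) a ≤ spaceWeight g a ∧
      spaceWeight g a ≤ spaceWeight (x₁ * g) a + 2 := by
    rw [spaceWeight_first ha h, spaceWeight_x₁_mul_first hroot ha h]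
    by_cases hr : KeyRight g a
    · rw [if_pos hr]
      generalize spaceLabel a = s
      by_cases hk : k = 0 <;> simp only [hk, if_true, if_false] <;> cases s <;> decide
    · rw [if_neg hr, spaceLabel_root_of_pos (of_not_keyRight ha hr).1 (of_not_keyRight ha hr).2]
      have hk : k = 0 := by
        by_contra hk
        refine hr ⟨a, ha, le_rfl, Or.inr (Or.inr ?_)⟩
        rw [h]
        simp [hk]
      simp only [hk, if_true]
      decide
  omega

theorem len_letter_mul (s : Letter) (g : F) : len (s.val * g) ≤ len g + 1 := by
  cases s with
  | x0 => exact (len_x₀_mul g).1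
  | x1 => exact (len_x₁_mul g).1
  | x0inv =>
    have := (len_x₀_mul (x₀⁻¹ * g)).2
    rwa [mul_inv_cancel_left] at this
  | x1inv =>
    have := (len_x₁_mul (x₁⁻¹ * g)).2
    rwa [mul_inv_cancel_left] at this

/-! ### Reading labels -/

theorem of_spaceLabel_eq_L {a : Address} (h : spaceLabel a = .L) :
    (∀ b ∈ a.path, b = false) ∧ a.tree ≤ 0 := by
  unfold spaceLabel at h
  split_ifs at h with h1
  exact h1

theorem of_spaceLabel_eq_N {a : Address} (h : spaceLabel a = .N) : ∃ p, a.path = p ++ [false] := by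
  unfold spaceLabel at h
  split_ifs at h with h1 h2
  exact List.getLast?_eq_some_iff.1 h2

theorem of_spaceLabel_eq_R {a : Address} (h : spaceLabel a = .R) : a.path = [] ∧ 0 < a.tree := by
  unfold spaceLabel at h
  split_ifs at h with h1 h2 h3
  have hp : a.path = [] := by
    rcases a.path.eq_nil_or_concat with hp | ⟨q, b, hp⟩
    · exact hp
    · rw [List.concat_eq_append] at hp
      have := h3 b (by simp [hp])
      subst this
      simp [hp] at h2
  refine ⟨hp, ?_⟩
  by_contra hc
  exact h1 ⟨h3, not_lt.1 hc⟩

theorem of_spaceLabel_eq_I {a : Address} (h : spaceLabel a = .I) : ∃ p, a.path = p ++ [true] := by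
  unfold spaceLabel at h
  split_ifs at h with h1 h2 h3
  rcases a.path.eq_nil_or_concat with hp | ⟨q, b, hp⟩
  · simp [hp] at h3
  · rw [List.concat_eq_append] at hp
    cases b
    · simp [hp] at h2
    · exact ⟨q, hp⟩

theorem spaceLabel_eq_I {a : Address} {p : List Bool} (h : a.path = p ++ [true]) :
    spaceLabel a = .I := by
  unfold spaceLabel
  simp [h]

/-- Used to place a column under the left sibling of the column that follows it. -/
theorem exists_eq_append_false {p s r : List Bool} (h1 : p ++ false :: s ≤ r)
    (h2 : r < p ++ [true]) : ∃ q, r = p ++ false :: q := by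
  induction p generalizing r with
  | nil =>
    match r with
    | [] => exact absurd h1 (not_le.2 (by simp))
    | false :: r => exact ⟨r, rfl⟩
    | true :: r =>
      simp at h2
  | cons b p ih =>
    match r with
    | [] => exact absurd h1 (not_le.2 (by simp))
    | d :: r =>
      rw [List.cons_append, List.cons_lt_cons_iff] at h2
      rw [List.cons_append, ← not_lt, List.cons_lt_cons_iff] at h1
      push Not at h1
      have hbd : d = b := by
        rcases h2 with h2 | h2
        · exact absurd h2 (not_lt.2 h1.1)
        · exact h2.1
      subst hbd
      obtain ⟨q, rfl⟩ := ih (h1.2 rfl) (by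
        rcases h2 with h2 | h2
        · exact absurd h2 (lt_irrefl _)
        · exact h2.2)
      exact ⟨q, rfl⟩

/-! ### Descent steps -/

open Classical in
theorem len_of_right {f : F} {a : Address} {k : ℕ} (ha : IsCol f a)
    (h : img f a = toLex (1, List.replicate k false))
    (hw : (if KeyRight f a then weight (if k = 0 then .R else .N) (spaceLabel a) else 0) =
      (if KeyLeft f a then weight .L (spaceLabel a) else 0) + 1) :
    len f = len (x₀ * f) + 1 := by
  have h1 := totalWeight_of_eq_off (fun b hb => spaceWeight_x₀_mul_of_ne (a := b) ha h hb)
  rw [spaceWeight_first ha h, spaceWeight_x₀_mul_first ha h, hw] at h1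
  unfold len
  rw [caretCount_x₀_mul]
  omega

theorem reg_x₀_inv_mul (f : F) : Reg (x₀⁻¹ * f) = Reg f := by
  have := reg_x₀_mul (x₀⁻¹ * f)
  rwa [mul_inv_cancel_left, eq_comm] at this

theorem key_x₀_inv_mul {f : F} {b : Address} (hb : IsCol f b) :
    Key (x₀⁻¹ * f) b ↔ Key f b := by
  have := key_x₀_mul (g := x₀⁻¹ * f) ((isCol_congr (reg_x₀_inv_mul f)).2 hb)
  rwa [mul_inv_cancel_left, iff_comm] at this

theorem keyLeft_x₀_inv_mul {f : F} {a : Address} : KeyLeft (x₀⁻¹ * f) a ↔ KeyLeft f a := by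
  unfold KeyLeft
  simp only [isCol_congr (reg_x₀_inv_mul f)]
  exact exists_congr fun b => and_congr_right fun hb => by rw [key_x₀_inv_mul hb]

theorem keyRight_x₀_inv_mul {f : F} {a : Address} : KeyRight (x₀⁻¹ * f) a ↔ KeyRight f a := by
  unfold KeyRight
  simp only [isCol_congr (reg_x₀_inv_mul f)]
  exact exists_congr fun b => and_congr_right fun hb => by rw [key_x₀_inv_mul hb]

open Classical in
-- The pointer formulas are applied to `x₀⁻¹ * f`, in which the trivial top tree 0 of `f` has become
-- tree 1.
theorem len_of_left {f : F} {a : Address} (ha : IsCol f a) (h : img f a = toLex (0, []))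
    (hw : (if KeyLeft f a then weight .L (spaceLabel a) else 0) =
      (if KeyRight f a then weight .R (spaceLabel a) else 0) + 1) :
    len f = len (x₀⁻¹ * f) + 1 := by
  have ha' : IsCol (x₀⁻¹ * f) a := (isCol_congr (reg_x₀_inv_mul f)).2 ha
  have h' : img (x₀⁻¹ * f) a = toLex (1, List.replicate 0 false) := by
    rw [((maps_x₀_inv _).mul ha.maps).img_eq, h]; rfl
  have h1 := totalWeight_of_eq_off (fun b hb => spaceWeight_x₀_mul_of_ne (a := b) ha' h' hb)
  rw [spaceWeight_first ha' h', spaceWeight_x₀_mul_first ha' h', keyLeft_x₀_inv_mul, hw,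
    keyRight_x₀_inv_mul, mul_inv_cancel_left] at h1
  simp only [if_true] at h1
  have h2 := caretCount_x₀_mul (x₀⁻¹ * f)
  rw [mul_inv_cancel_left] at h2
  unfold len
  omega

/-- `s * g` is longer than `g`, and multiplication by `s` creates a caret if `s = x₁^{±1}`. -/
structure Ascends (s : Letter) (g : F) : Prop where
  len_eq : len (s.val * g) = len g + 1
  top : s = .x1 → toLex (0, []) ∉ Reg (x₁ * g)⁻¹
  bot : s = .x1inv → toLex (0, []) ∈ Reg g⁻¹

theorem exists_descent_of_right {f : F} (h : len f = len (x₀ * f) + 1) :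
    ∃ s g, f = Letter.val s * g ∧ Ascends s g :=
  ⟨.x0inv, x₀ * f, (inv_mul_cancel_left _ _).symm,
    by change len (x₀⁻¹ * (x₀ * f)) = _; rwa [inv_mul_cancel_left], by simp, by simp⟩

theorem exists_descent_of_left {f : F} (h : len f = len (x₀⁻¹ * f) + 1) :
    ∃ s g, f = Letter.val s * g ∧ Ascends s g :=
  ⟨.x0, x₀⁻¹ * f, (mul_inv_cancel_left _ _).symm,
    by change len (x₀ * (x₀⁻¹ * f)) = _; rwa [mul_inv_cancel_left], by simp, by simp⟩

theorem exists_descent_of_cancel {f : F} {c : Address} (hc : Maps (x₁ * f) c (toLex (0, []))) :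
    ∃ s g, f = Letter.val s * g ∧ Ascends s g := by
  refine ⟨.x1inv, x₁ * f, (inv_mul_cancel_left _ _).symm, ?_, by simp, fun _ => hc.reg_inv⟩
  change len (x₁⁻¹ * (x₁ * f)) = _
  rw [inv_mul_cancel_left, len, len, totalWeight_cancel hc, caretCount_cancel hc]
  ring

/-- Undoing the root caret of the current tree shortens the element unless it turns a space `{I, R}`
into `{R, R}` inside the support. In that case the pointer is moved right instead: the space it
crosses has bottom label `N` or `R`, and its weight drops from 2 to 1. -/
theorem exists_descent_of_nontrivial {f : F} (hroot : toLex (0, []) ∉ Reg f⁻¹) :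
    ∃ s g, f = Letter.val s * g ∧ Ascends s g := by
  classical
  obtain ⟨g, rfl⟩ : ∃ g, f = x₁ * g := ⟨x₁⁻¹ * f, (mul_inv_cancel_left _ _).symm⟩
  obtain ⟨a, k, ha, h⟩ := exists_first g 1
  have hcol : ∀ {b}, IsCol (x₁ * g) b ↔ IsCol g b := isCol_congr (reg_x₁_mul hroot)
  have h1 := totalWeight_of_eq_off (fun b hb => spaceWeight_x₁_mul_of_ne (a := b) hroot ha h hb)
  by_cases hw : spaceWeight (x₁ * g) a = spaceWeight g a
  · refine ⟨.x1, g, rfl, ?_, fun _ => hroot, by simp⟩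
    change len (x₁ * g) = _
    rw [len, len, caretCount_x₁_mul hroot]
    omega
  rw [spaceWeight_first ha h, spaceWeight_x₁_mul_first hroot ha h] at hw
  have hr : KeyRight g a := by
    by_contra hr
    obtain ⟨ht, hp⟩ := of_not_keyRight ha hr
    have hk : k = 0 := by
      by_contra hk
      refine hr ⟨a, ha, le_rfl, Or.inr (Or.inr ?_)⟩
      rw [h]
      simp [hk]
    rw [if_neg hr, spaceLabel_root_of_pos ht hp] at hw
    simp [hk, weight] at hw
  rw [if_pos hr] at hw
  have hk : k = 0 := by
    by_contra hk
    simp [hk] at hw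
  subst hk
  simp only [if_true] at hw
  have hlab : spaceLabel a = .R := by
    revert hw
    cases spaceLabel a <;> simp [weight]
  obtain ⟨hp, ht⟩ := of_spaceLabel_eq_R hlab
  obtain ⟨b, hb, hab, hkey⟩ := hr
  have hne : a ≠ b := by
    rintro rfl
    rcases hkey with h | h | h'
    · omega
    · exact h hp
    · rw [h] at h'
      exact h' rfl
  have hab := lt_of_le_of_ne hab hne
  -- in `x₁ * g` the column `b` lies to the right of the current tree
  have hbt : 2 ≤ (img g b).tree := by
    have h2 := (first_le_iff ha h hb).1 hab.le
    rcases h2.eq_or_lt with h2 | h2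
    · have := ha.img_path_ne_nil hb (by rw [h]; exact h2) hne
      rw [h] at this
      exact absurd rfl this
    · omega
  have hfa : img (x₁ * g) a = toLex (0, [true]) := by
    rw [img_x₁_mul ha.reg, h, attachAddr_of_one (by rfl)]; rfl
  have hfb : img (x₁ * g) b = toLex ((img g b).tree - 1, (img g b).path) := by
    rw [img_x₁_mul hb.reg, attachAddr_of_two_le hbt]
  obtain ⟨c, j, hc, hcj⟩ := exists_first (x₁ * g) 1
  have hR : KeyRight (x₁ * g) c := by
    refine ⟨b, hcol.2 hb, (first_le_iff hc hcj (hcol.2 hb)).2 (by rw [hfb, Address.tree_mk]; omega),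
      ?_⟩
    unfold Key
    rw [hfb]
    exact hkey
  have hac : a < c := (lt_first_iff hc hcj (hcol.2 ha)).2 (by rw [hfa]; exact zero_lt_one)
  have hL : KeyLeft (x₁ * g) c :=
    ⟨a, hcol.2 ha, hac, Or.inr (Or.inr (by rw [hfa]; simp))⟩
  have htree := IsCol.tree_le_of_lt hac
  have hnL : spaceLabel c ≠ .L := fun hl => by
    have := (of_spaceLabel_eq_L hl).2
    omega
  -- If `c` were a right child, a column `d` under its sibling would lie strictly between `a` and
  -- `c`. But the image of `a` ends at 1, the right end of top tree 0, which leaves no room for the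
  -- image of `d`.
  have hnI : spaceLabel c ≠ .I := fun hl => by
    obtain ⟨p, hcp⟩ := of_spaceLabel_eq_I hl
    obtain ⟨d, s, hd, hd1, hd2, hd3⟩ := hc.exists_sibling_left hcp
    have had : a < d := by
      by_contra hda
      rcases (not_lt.1 hda).eq_or_lt with e | hlt
      · rw [e, hp] at hd2
        simp at hd2
      · have h5 := IsCol.tree_le_of_lt hlt
        exact (hcol.2 ha).path_ne_nil hd (by omega) hlt.ne' hp
    have h5 := (lt_first_iff hc hcj hd).1 hd3
    have h6 := (hcol.2 ha).img_lt hd had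
    have h7 := (hcol.2 ha).img_isCol.end_le hd.img_isCol h6
    have h8 := (img (x₁ * g) d).start_bounds.2
    have h9 := (img (x₁ * g) d).size_pos
    have h10 : ((img (x₁ * g) d).tree : ℝ) ≤ 0 := by
      exact_mod_cast (show (img (x₁ * g) d).tree ≤ 0 by omega)
    rw [hfa] at h7
    have e : Address.start (toLex (0, [true])) + Address.size (toLex (0, [true])) = 1 := by
      simp [Address.start, Address.size, pathStart]; norm_num
    linarith
  refine exists_descent_of_right (len_of_right hc hcj ?_)
  rw [if_pos hR, if_pos hL]
  revert hnL hnI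
  generalize spaceLabel c = s
  by_cases hj : j = 0 <;> simp only [hj, if_true, if_false] <;> cases s <;> simp [weight]

/-- If all columns other than `[0, 1]` are trivial then the element is trivial. -/
theorem eq_one_of_trivial {f : F}
    (h0 : img f (toLex (0, [])) = toLex (0, []))
    (h : ∀ a, IsCol f a → a.path = [] ∧ (img f a).path = []) : f = 1 := by
  have hcol : ∀ i : ℤ, ∃ j : ℤ, Maps f (toLex (i, [])) (toLex (j, [])) := by
    intro i
    obtain ⟨k, hk⟩ := exists_leftmost f i
    have h1 := h _ hk
    have h2 := hk.maps
    rw [show (toLex (i, List.replicate k false) : Address) = toLex (i, []) from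
      Address.mk_eq rfl h1.1] at h2 h1
    refine ⟨(img f (toLex (i, []))).tree, ?_⟩
    rwa [show img f (toLex (i, [])) = toLex ((img f (toLex (i, []))).tree, []) from
      Address.mk_eq rfl h1.2] at h2
  have hval : ∀ i : ℤ, ∃ j : ℤ, ∀ t : ℝ, (i : ℝ) ≤ t → t ≤ i + 1 → f.1 t = j + (t - i) := by
    intro i
    obtain ⟨j, hj⟩ := hcol i
    refine ⟨j, fun t h1 h2 => ?_⟩
    have := hj t ⟨by simpa [Address.start, pathStart] using h1,
      by simpa [Address.start, Address.size, pathStart] using h2⟩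
    simpa [Address.start, Address.size, pathStart] using this
  have hstep : ∀ i : ℤ, f.1 ((i : ℝ) + 1) = f.1 i + 1 := by
    intro i
    obtain ⟨j, hj⟩ := hval i
    rw [hj _ (by linarith) le_rfl, hj i le_rfl (by linarith)]
    ring
  have hint : ∀ i : ℤ, f.1 (i : ℝ) = i := by
    intro i
    induction i using Int.induction_on with
    | zero =>
      obtain ⟨j, hj⟩ := hcol 0
      rw [hj.img_eq] at h0
      have := hj.apply_start
      rw [h0] at this
      simpa [Address.start, pathStart] using this
    | succ i ih =>
      have := hstep i
      rw [ih] at this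
      push_cast at this ⊢
      exact this
    | pred i ih =>
      have := hstep (-i - 1)
      push_cast at this ih ⊢
      rw [sub_add_cancel, ih] at this
      linarith
  apply Subtype.ext
  ext t
  obtain ⟨j, hj⟩ := hval ⌊t⌋
  have h1 := hj ⌊t⌋ le_rfl (by linarith)
  rw [hint] at h1
  rw [hj t (Int.floor_le t) (Int.lt_floor_add_one t).le]
  change _ = t
  linarith

/-- Let `a₀` be the column under the trivial current tree and `a₁` the next one. If neither pointer
move shortens, the weight table restricts the bottom labels of both so strongly that either `x₁`
cancels a caret or `f = 1`. -/
theorem exists_descent_of_trivial {f : F} (hf : f ≠ 1) (hroot : toLex (0, []) ∈ Reg f⁻¹) :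
    ∃ s g, f = Letter.val s * g ∧ Ascends s g := by
  classical
  by_contra hcon
  obtain ⟨a₀, h0, hm0⟩ := exists_isCol_img (f := f) (b := toLex (0, []))
    ⟨hroot, fun q b hq => by simp at hq⟩
  obtain ⟨a₁, k, h1, hm1⟩ := exists_first f 1
  have hlt : a₀ < a₁ := (lt_first_iff h1 hm1 h0).2 (by rw [hm0]; exact zero_lt_one)
  have hnext : ∀ b, IsCol f b → a₀ < b → a₁ ≤ b := by
    intro b hb hab
    have h2 := h0.img_lt hb hab
    have h3 := IsCol.tree_le_of_lt h2
    rw [hm0, Address.tree_mk] at h3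
    refine (first_le_iff h1 hm1 hb).2 ?_
    rcases h3.eq_or_lt with h4 | h4
    · have := h0.img_path_ne_nil hb (by rw [hm0]; exact h4) hab.ne
      rw [hm0] at this
      exact absurd rfl this
    · omega
  -- Replacing the top label `L` by `R` increases the weight only against `N` and `R`, and only if
  -- the space remains in the support.
  have hleft : KeyLeft f a₀ → KeyRight f a₀ ∧ (spaceLabel a₀ = .N ∨ spaceLabel a₀ = .R) := by
    intro hl
    by_contra hc
    refine hcon (exists_descent_of_left (len_of_left h0 hm0 ?_))
    rw [if_pos hl]
    by_cases hr : KeyRight f a₀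
    · rw [if_pos hr]
      revert hc
      cases spaceLabel a₀ <;> simp [weight, hr]
    · rw [if_neg hr, spaceLabel_root_of_pos (of_not_keyRight h0 hr).1 (of_not_keyRight h0 hr).2]
      rfl
  -- Replacing the top label `R` or `N` by `L` increases the weight only against a bottom `L`, or
  -- from `{R, I}`.
  have hright : KeyRight f a₁ →
      KeyLeft f a₁ ∧ (spaceLabel a₁ = .L ∨ spaceLabel a₁ = .I ∧ k = 0) := by
    intro hr
    by_contra hc
    refine hcon (exists_descent_of_right (len_of_right h1 hm1 ?_))
    rw [if_pos hr]
    by_cases hl : KeyLeft f a₁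
    · rw [if_pos hl]
      revert hc
      by_cases hk : k = 0 <;> simp only [hk, if_true, if_false] <;> cases spaceLabel a₁ <;>
        simp [weight, hl]
    · rw [if_neg hl, spaceLabel_eq_L (of_not_keyLeft h1 hl).2 (of_not_keyLeft h1 hl).1]
      by_cases hk : k = 0 <;> simp only [hk, if_true, if_false] <;> rfl
  have hsib : ∀ p, a₀.path = p ++ [false] →
      a₁.tree = a₀.tree ∧ (¬ ∀ d ∈ a₁.path, d = false) ∧ KeyRight f a₁ := by
    intro p hp
    obtain ⟨b, s, hb, hb1, hb2, hb3⟩ := h0.exists_sibling hp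
    have h2 := hnext b hb hb3
    have h3 := IsCol.tree_le_of_le h2
    have h4 := IsCol.tree_le_of_lt hlt
    have h5 : a₁.tree = a₀.tree := by omega
    refine ⟨h5, fun hall => ?_, b, hb, h2, Or.inr (Or.inl (by simp [hb2]))⟩
    have e : a₁ = toLex (a₀.tree, List.replicate a₁.path.length false) :=
      Address.mk_eq h5 (List.eq_replicate_iff.2 ⟨rfl, hall⟩)
    have h1' := h1
    rw [e] at h1'
    have := h1'.leftmost_le h0 le_rfl
    rw [← e] at this
    exact absurd hlt (not_lt.2 this)
  by_cases hR : KeyRight f a₁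
  · obtain ⟨hL, hlab | ⟨hlab, rfl⟩⟩ := hright hR
    -- Here `a₁` starts its bottom tree, so `a₀` is not a left child and has nonpositive index;
    -- labels `N` and `R` are excluded and nothing to the left of `a₀` is keyed. Then `a₀` is the
    -- keyed column required by `hL`, although its tree is trivial and cannot have index 0.
    · obtain ⟨hall, ht⟩ := of_spaceLabel_eq_L hlab
      have hnot : ∀ p, a₀.path ≠ p ++ [false] := fun p hp => (hsib p hp).2.1 hall
      have ht' := IsCol.tree_le_of_lt hlt
      by_cases hl : KeyLeft f a₀
      · rcases (hleft hl).2 with h | h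
        · obtain ⟨p, hp⟩ := of_spaceLabel_eq_N h
          exact hnot p hp
        · have := (of_spaceLabel_eq_R h).2
          omega
      · obtain ⟨b, hb, hb1, hb2⟩ := hL
        have hba : b = a₀ := by
          rcases lt_trichotomy b a₀ with h | h | h
          · exact absurd ⟨b, hb, h, hb2⟩ hl
          · exact h
          · exact absurd hb1 (not_lt.2 (hnext b hb h))
        subst hba
        obtain ⟨h2, h3⟩ := of_not_keyLeft h0 hl
        have hp : b.path = [] := by
          rcases b.path.eq_nil_or_concat with hp | ⟨q, d, hp⟩
          · exact hp
          · rw [List.concat_eq_append] at hp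
            have := h3 d (by simp [hp])
            subst this
            exact absurd hp (hnot q)
        rcases hb2 with h4 | h4 | h4
        · exact h0.path_ne_nil h1 (by omega) hlt.ne hp
        · exact h4 hp
        · rw [hm0] at h4
          exact h4 rfl
    · obtain ⟨p, hp⟩ := of_spaceLabel_eq_I hlab
      obtain ⟨b, s, hb, hb1, hb2, hb3⟩ := h1.exists_sibling_left hp
      have hba : b ≤ a₀ := by
        by_contra hc
        exact absurd hb3 (not_lt.2 (hnext b hb (not_le.1 hc)))
      have ht : a₀.tree = a₁.tree := by
        have h2 := IsCol.tree_le_of_le hba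
        have h3 := IsCol.tree_le_of_lt hlt
        omega
      obtain ⟨q, hq⟩ : ∃ q, a₀.path = p ++ false :: q := by
        apply exists_eq_append_false (s := s)
        · rw [← hb2]
          rcases hba.eq_or_lt with h | h
          · rw [h]
          · rcases Address.lt_iff.1 h with h | h
            · omega
            · exact h.2.le
        · rw [← hp]
          rcases Address.lt_iff.1 hlt with h | h
          · omega
          · exact h.2
      -- If `a₀` is the sibling of `a₁`, then `x₁` cancels their common caret. Otherwise a last bit
      -- `false` of `a₀` would put a column between `a₀` and `a₁`, and a last bit `true` gives it
      -- label `I` with a keyed column to its left, contrary to `hleft`.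
      rcases q.eq_nil_or_concat with rfl | ⟨q, d, rfl⟩
      · have e0 : a₀ = Address.left (toLex (a₁.tree, p)) := Address.mk_eq ht hq
        have e1 : a₁ = Address.right (toLex (a₁.tree, p)) := Address.mk_eq rfl hp
        have m0 := (maps_x₁ _).mul h0.maps
        have m1 := (maps_x₁ _).mul h1.maps
        rw [hm0, e0, attachAddr_of_zero (by rfl)] at m0
        rw [hm1, attachAddr_of_one (by rfl)] at m1
        rw [e1] at m1
        exact hcon (exists_descent_of_cancel (Maps.of_children (b := toLex (0, [])) m0 m1))
      · rw [List.concat_eq_append, ← List.cons_append, ← List.append_assoc] at hq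
        cases d
        · obtain ⟨b', s', hb', hb1', hb2', hb3'⟩ := h0.exists_sibling hq
          have h2 := hnext b' hb' hb3'
          have h3 : b' < a₁ := by
            refine Address.lt_iff.2 (Or.inr ⟨by omega, ?_⟩)
            rw [hb2', hp, List.append_assoc, append_lt_append_iff]
            simp [List.cons_lt_cons_iff]
          exact absurd h3 (not_lt.2 h2)
        · obtain ⟨b', s', hb', hb1', hb2', hb3'⟩ := h0.exists_sibling_left hq
          have hl := hleft ⟨b', hb', hb3', Or.inr (Or.inl (by simp [hb2']))⟩
          rw [spaceLabel_eq_I hq] at hl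
          simp at hl
  -- Nothing from `a₁` on is keyed. A keyed column left of `a₀` would by `hleft` force label `R`,
  -- hence an unkeyed `a₀`, contradicting `KeyRight f a₀`. So `a₀` is the only keyed column: all
  -- trees are trivial, the pointers are aligned, and `f = 1`.
  · have hnot : ∀ p, a₀.path ≠ p ++ [false] := fun p hp => hR (hsib p hp).2.2
    have hkey : ∀ b, IsCol f b → a₀ < b → ¬ Key f b := fun b hb hab hk =>
      hR ⟨b, hb, hnext b hb hab, hk⟩
    by_cases hl : KeyLeft f a₀
    · obtain ⟨⟨b, hb, hb1, hb2⟩, h⟩ := hleft hl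
      rcases h with h | h
      · obtain ⟨p, hp⟩ := of_spaceLabel_eq_N h
        exact hnot p hp
      · obtain ⟨hp, ht⟩ := of_spaceLabel_eq_R h
        rcases hb1.eq_or_lt with rfl | h2
        · rcases hb2 with h3 | h3 | h3
          · omega
          · exact h3 hp
          · rw [hm0] at h3
            exact h3 rfl
        · exact hkey b hb h2 hb2
    · have honly : ∀ b, IsCol f b → Key f b → b = a₀ := by
        intro b hb hk
        rcases lt_trichotomy b a₀ with h | h | h
        · exact absurd ⟨b, hb, h, hk⟩ hl
        · exact h
        · exact absurd hk (hkey b hb h)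
      obtain ⟨j, hj, hj'⟩ := exists_bottom_pointer f
      have e := honly _ hj hj'
      have hj0 : j = 0 := by
        rcases Nat.eq_zero_or_eq_succ_pred j with h | h
        · exact h
        · rw [h, List.replicate_succ'] at e
          exact absurd (congrArg Address.path e).symm (hnot _)
      subst hj0
      have e : a₀ = toLex (0, []) := e.symm
      refine hf (eq_one_of_trivial (by rwa [e] at hm0) fun b hb => ?_)
      by_cases hk : Key f b
      · rw [honly b hb hk, hm0, e]
        exact ⟨rfl, rfl⟩
      · unfold Key at hk
        push Not at hk
        exact hk.2

theorem exists_descent {f : F} (hf : f ≠ 1) : ∃ s g, f = Letter.val s * g ∧ Ascends s g := by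
  by_cases h : toLex (0, []) ∈ Reg f⁻¹
  · exact exists_descent_of_trivial hf h
  · exact exists_descent_of_nontrivial h

/-! ### Lengths of words -/

theorem reg_one : Reg (1 : F) = univ := eq_univ_of_forall fun a => (Maps.one a).reg

theorem caretCount_one : caretCount 1 = 0 := by
  simp [caretCount, reg_one]

theorem totalWeight_one : totalWeight 1 = 0 := by
  have hcol : ∀ b, IsCol 1 b → Marked 1 b → b = toLex (0, []) := by
    intro b hb hm
    have hp : b.path = [] := by
      rcases b.path.eq_nil_or_concat with hp | ⟨q, d, hp⟩
      · exact hp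
      · exact absurd (Maps.one _).reg (hb.2 q d (by simpa using hp))
    unfold Marked at hm
    rw [(Maps.one b).img_eq] at hm
    have ht : b.tree = 0 := by tauto
    exact Address.mk_eq ht hp
  unfold totalWeight
  rw [← finsum_zero (α := Address)]
  refine finsum_congr fun a => if_neg ?_
  rintro ⟨_, ⟨b, hb, hb1, hb2⟩, ⟨d, hd, hd1, hd2⟩⟩
  rw [hcol b hb hb2] at hb1
  rw [hcol d hd hd2] at hd1
  exact absurd hb1 (not_lt.2 hd1)

theorem len_one : len 1 = 0 := by rw [len, totalWeight_one, caretCount_one]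

theorem Word.eval_cons (s : Letter) (w : Word) : Word.eval (s :: w) = s.val * Word.eval w := by
  simp [Word.eval]

theorem len_eval_le (w : Word) : len w.eval ≤ w.length := by
  induction w with
  | nil => exact len_one.le
  | cons s w ih =>
    rw [Word.eval_cons, List.length_cons]
    have := len_letter_mul s (Word.eval w)
    omega

/-! ### Creation of carets -/

theorem carets_attachCaret (T : BinaryForest) :
    T.attachCaret.carets = insert (toLex (0, [])) (attachAddr '' T.carets) := by
  ext c
  by_cases hc : c = toLex (0, [])
  · subst hc
    simp [BinaryForest.mem_carets_attachCaret]
  obtain ⟨b, rfl⟩ := exists_attachAddr hc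
  obtain ⟨i, p, rfl⟩ : ∃ i p, b = toLex (i, p) := ⟨b.tree, b.path, rfl⟩
  rw [mem_insert_iff, or_iff_right hc, attachAddr_injective.mem_set_image]
  rcases lt_or_ge i 0 with h | h
  · rw [attachAddr_of_neg (b := toLex (i, p)) h, BinaryForest.mem_carets_attachCaret, if_pos h]
  obtain rfl | rfl | h : i = 0 ∨ i = 1 ∨ 2 ≤ i := by omega
  · rw [attachAddr_of_zero (by rfl), BinaryForest.mem_carets_attachCaret]
    simp
  · rw [attachAddr_of_one (by rfl), BinaryForest.mem_carets_attachCaret]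
    simp
  · have e : attachAddr (toLex (i, p)) = toLex (i - 1, p) :=
      attachAddr_of_two_le (b := toLex (i, p)) h
    rw [e, BinaryForest.mem_carets_attachCaret, if_neg (by omega), if_neg (by omega),
      sub_add_cancel]

/-- When tree 0 is trivial, inserting a trivial tree next to it is the action of `x₁⁻¹` on the
carets. -/
theorem mem_carets_insertTrivial_iff {T : BinaryForest} (hT : T 0 = .nil) (c : Address) :
    c ∈ T.insertTrivial.carets ↔ attachAddr c ∈ T.carets := by
  obtain ⟨i, p, rfl⟩ : ∃ i p, c = toLex (i, p) := ⟨c.tree, c.path, rfl⟩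
  have h0 : ∀ p, toLex (0, p) ∉ T.carets := by
    intro p hp
    rw [BinaryForest.mem_carets, Address.tree_mk, hT] at hp
    exact not_isCaret_nil _ hp
  rw [BinaryForest.mem_carets_insertTrivial]
  rcases lt_or_ge i 0 with h | h
  · rw [attachAddr_of_neg (b := toLex (i, p)) h, if_pos h.le]
  obtain rfl | rfl | h : i = 0 ∨ i = 1 ∨ 2 ≤ i := by omega
  · rw [attachAddr_of_zero (by rfl)]
    simp [h0]
  · rw [attachAddr_of_one (by rfl)]
    simp [h0]
  · rw [attachAddr_of_two_le (b := toLex (i, p)) h, if_neg (by omega)]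
    simp only [Address.tree_mk, Address.path_mk, and_iff_right_iff_imp]
    intro _
    omega

theorem carets_top_diagram (f : F) : (diagram f).top.carets = (Reg f⁻¹)ᶜ := carets_regForest _

theorem carets_bot_diagram (f : F) : (diagram f).bot.carets = (Reg f)ᶜ := carets_regForest _

theorem createsTopCaret_of_root {g : F} (h : toLex (0, []) ∉ Reg (x₁ * g)⁻¹) :
    CreatesTopCaret (x₁ * g) (diagram (x₁ * g)) g := by
  refine ⟨diagram g, diagram (x₁ * g), diagram_isReducedFor _, diagram_isReducedFor _, ?_, ?_,
    toLex (0, []), ?_, rfl, rfl⟩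
  · exact BinaryForest.ext_carets (by rw [carets_bot_diagram, carets_bot_diagram, reg_x₁_mul h])
  · exact BinaryForest.ext_carets (by
      rw [carets_attachCaret, carets_top_diagram, carets_top_diagram, compl_reg_inv_x₁_mul h])
  · rw [carets_top_diagram]
    exact h

/-- Splitting the column under a trivial current tree is a cancellation by `x₁` read backwards, so
the cancellation lemmas supply all the data. -/
theorem createsBottomCaret_of_root {g : F} (h : toLex (0, []) ∈ Reg g⁻¹) :
    CreatesBottomCaret (diagram (x₁⁻¹ * g)) g := by
  obtain ⟨f, rfl⟩ : ∃ f, g = x₁ * f := ⟨x₁⁻¹ * g, (mul_inv_cancel_left _ _).symm⟩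
  rw [inv_mul_cancel_left]
  obtain ⟨c, hc⟩ := id h
  have hc := Maps.inv_iff.1 hc
  refine ⟨diagram (x₁ * f), diagram f, diagram_isReducedFor _, ?_,
    ⟨c, isLeaf_regForest.2 ((isCol_of_cancel hc).2 (Or.inl rfl))⟩, hc.img_eq, ?_, ?_, ?_⟩
  · rw [inv_mul_cancel_left]
    exact diagram_isReducedFor _
  · rw [carets_bot_diagram, carets_bot_diagram, compl_reg_cancel hc]
  · have h0 : (diagram (x₁ * f)).top 0 = .nil := by
      by_contra h0
      have : toLex (0, []) ∈ (diagram (x₁ * f)).top.carets := isCaret_nil_iff.2 h0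
      rw [carets_top_diagram] at this
      exact this h
    refine BinaryForest.ext_carets (Set.ext fun b => ?_)
    rw [mem_carets_insertTrivial_iff h0, carets_top_diagram, carets_top_diagram, mem_compl_iff,
      mem_compl_iff, reg_mul_iff (maps_x₁ b)]
  · rw [carets_bot_diagram]
    exact not_reg_of_cancel hc

/-- Only `x₁⁻¹` fails to act on some vertex, the root of tree 0; that root is not a caret when
`x₁⁻¹` ascends. -/
theorem Ascends.exists_maps {s : Letter} {g : F} (h : Ascends s g) {d : Address}
    (hd : d ∉ Reg g⁻¹) : ∃ d', Maps s.val d d' := by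
  cases s with
  | x0 => exact ⟨_, maps_x₀ d⟩
  | x0inv => exact ⟨_, maps_x₀_inv d⟩
  | x1 => exact ⟨_, maps_x₁ d⟩
  | x1inv =>
    obtain ⟨b, rfl⟩ := exists_attachAddr (c := d) (fun e => hd (e ▸ h.bot rfl))
    exact ⟨b, (maps_x₁ b).inv⟩

theorem Ascends.reg_subset {s : Letter} {g : F} (h : Ascends s g) : Reg (s.val * g) ⊆ Reg g := by
  cases s with
  | x0 => exact (reg_x₀_mul g).subset
  | x0inv => exact (reg_x₀_inv_mul g).subset
  | x1 => exact (reg_x₁_mul (h.top rfl)).subset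
  | x1inv =>
    have := reg_subset_mul (g := x₁⁻¹ * g) fun b => ⟨_, maps_x₁ b⟩
    rwa [mul_inv_cancel_left] at this

/-- An ascending letter moves a top caret to another address but leaves the part of the domain line
spanned by its children unchanged. -/
theorem CreatesTopCaret.mul {s : Letter} {g h : F} (hs : Ascends s g)
    (hc : CreatesTopCaret g (diagram g) h) :
    CreatesTopCaret (s.val * g) (diagram (s.val * g)) h := by
  obtain ⟨E, E', h1, h2, h3, h4, d, hd, h5, h6⟩ := hc
  rw [carets_top_diagram] at hd
  obtain ⟨d', hd'⟩ := hs.exists_maps hd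
  refine ⟨E, E', h1, h2, h3, h4, d', ?_, ?_, ?_⟩
  · rw [carets_top_diagram]
    exact fun h => hd ((reg_mul_iff hd').1 h)
  · rw [h5, ← hd'.left.preimage]
    rfl
  · rw [h6, ← hd'.right.preimage]
    rfl

theorem CreatesBottomCaret.mul {s : Letter} {g h : F} (hs : Ascends s g)
    (hc : CreatesBottomCaret (diagram g) h) : CreatesBottomCaret (diagram (s.val * g)) h := by
  obtain ⟨E, E', h1, h2, a, h3, h4, h5, h6⟩ := hc
  refine ⟨E, E', h1, h2, a, h3, h4, h5, ?_⟩
  rw [carets_bot_diagram] at h6 ⊢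
  exact fun h => h6 (hs.reg_subset h)

theorem exists_word (n : ℕ) (f : F) (hn : len f = n) :
    ∃ w : Word, w.eval = f ∧ w.length = n ∧
      (∀ u v : Word, w = u ++ Letter.x1 :: v → CreatesTopCaret f (diagram f) v.eval) ∧
      ∀ u v : Word, w = u ++ Letter.x1inv :: v → CreatesBottomCaret (diagram f) v.eval := by
  induction n generalizing f with
  | zero =>
    -- Length zero forces the identity, since a descent would need a negative length.
    by_cases hf : f = 1
    · subst hf
      exact ⟨[], rfl, rfl, fun u v h => by simp at h, fun u v h => by simp at h⟩
    · obtain ⟨s, g, rfl, hs⟩ := exists_descent hf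
      have := hs.len_eq
      omega
  | succ n ih =>
    have hf : f ≠ 1 := by
      rintro rfl
      rw [len_one] at hn
      omega
    obtain ⟨s, g, rfl, hs⟩ := exists_descent hf
    obtain ⟨w, rfl, hl, h1, h2⟩ := ih g (by have := hs.len_eq; omega)
    refine ⟨s :: w, Word.eval_cons s w, by simp [hl], ?_, ?_⟩
    · intro u v h
      cases u with
      | nil =>
        obtain ⟨rfl, rfl⟩ := List.cons_eq_cons.1 h
        exact createsTopCaret_of_root (hs.top rfl)
      | cons d u =>
        exact (h1 u v (List.cons_eq_cons.1 h).2).mul hs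
    · intro u v h
      cases u with
      | nil =>
        obtain ⟨rfl, rfl⟩ := List.cons_eq_cons.1 h
        exact createsBottomCaret_of_root (hs.bot rfl)
      | cons d u =>
        exact (h2 u v (List.cons_eq_cons.1 h).2).mul hs

/-! ### Letter counts in creating words -/

theorem CreatesTopCaret.caretCount {f g : F} {D : ForestDiagram} (h : CreatesTopCaret f D g) :
    caretCount (x₁ * g) = caretCount g + 1 := by
  obtain ⟨E, E', -, h2, -, h4, -⟩ := h
  apply caretCount_x₁_mul
  have : toLex (0, []) ∈ E'.top.carets := by
    rw [h4, carets_attachCaret]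
    exact mem_insert _ _
  rwa [(carets_of_isReducedFor h2).2] at this

theorem CreatesBottomCaret.caretCount {g : F} {D : ForestDiagram}
    (h : CreatesBottomCaret D g) : caretCount (x₁⁻¹ * g) = caretCount g + 1 := by
  obtain ⟨E, E', h1, -, a, h3, -⟩ := h
  have hm := h1.1.maps a
  rw [h3] at hm
  have := caretCount_cancel (g := x₁⁻¹ * g) (c := a.1) (by rwa [mul_inv_cancel_left])
  rwa [mul_inv_cancel_left] at this

/-- Stated for all suffixes `v`, because a letter acts on the element represented by what stands to
its right. -/
theorem IsCreatingWord.count_eq {f : F} {D : ForestDiagram} {w : Word}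
    (h : IsCreatingWord f D w) (u v : Word) (hw : w = u ++ v) :
    v.count Letter.x1 + v.count Letter.x1inv = caretCount v.eval := by
  induction v generalizing u with
  | nil => exact caretCount_one.symm
  | cons s v ih =>
    have ih := ih (u ++ [s]) (by simp [hw])
    rw [Word.eval_cons]
    cases s with
    | x0 =>
      change _ = ThompsonF.caretCount (x₀ * _)
      rw [caretCount_x₀_mul, ← ih]
      simp
    | x0inv =>
      have := caretCount_x₀_mul (x₀⁻¹ * Word.eval v)
      rw [mul_inv_cancel_left] at this
      change _ = ThompsonF.caretCount (x₀⁻¹ * _)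
      rw [← this, ← ih]
      simp
    | x1 =>
      change _ = ThompsonF.caretCount (x₁ * _)
      rw [(h.top u v hw).caretCount, ← ih]
      simp
      ring
    | x1inv =>
      change _ = ThompsonF.caretCount (x₁⁻¹ * _)
      rw [(h.bot u v hw).caretCount, ← ih]
      simp
      ring

theorem length_eq_sum_count (w : Word) : w.length = w.count Letter.x0 + w.count Letter.x0inv +
    (w.count Letter.x1 + w.count Letter.x1inv) := by
  induction w with
  | nil => rfl
  | cons s w ih => cases s <;> simp [ih] <;> ring

end

end ThompsonF

theorem corollary4p3p8 (f : ThompsonF.F) :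
    ∃ D : ThompsonF.ForestDiagram,
      (D.IsReducedFor f ∧ ∀ E : ThompsonF.ForestDiagram, E.IsReducedFor f → E = D) ∧
      (∃ w : ThompsonF.Word, ThompsonF.IsCreatingWord f D w) ∧
      ∀ w : ThompsonF.Word, ThompsonF.IsCreatingWord f D w →
        w.count ThompsonF.Letter.x1 + w.count ThompsonF.Letter.x1inv = D.ell₁ ∧
        w.count ThompsonF.Letter.x0 + w.count ThompsonF.Letter.x0inv = D.ell₀ := by
  obtain ⟨w₀, h1, h2, h3, h4⟩ := ThompsonF.exists_word _ f rfl
  refine ⟨ThompsonF.diagram f, ⟨ThompsonF.diagram_isReducedFor f,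
    fun E hE => ThompsonF.eq_diagram hE⟩, ⟨w₀, ⟨h1, fun v hv => ?_⟩, h3, h4⟩, fun w hw => ?_⟩
  · rw [h2, ← hv]
    exact ThompsonF.len_eval_le v
  -- Comparison with `w₀` and the lower bound `len_eval_le` give `w` length exactly `len f`;
  -- removing the letters counted by the carets leaves the total weight.
  · have e1 := hw.count_eq [] w rfl
    have e2 := hw.minimal.2 w₀ h1
    have e3 := ThompsonF.len_eval_le w
    have e4 := ThompsonF.length_eq_sum_count w
    rw [hw.minimal.1] at e1 e3
    rw [ThompsonF.ell₀_diagram, ThompsonF.ell₁_diagram]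
    unfold ThompsonF.len at h2 e3
    unfold ThompsonF.caretCount at h2 e1 e3
    omega
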